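/- An ordered graph is a finite simple graph $G=(V,E)$ together with an injective function $\varphi:V\to\mathbb{R}$. Two ordered graphs are isomorphic if there is a bijection between their vertex sets that preserves and reflects both adjacency and the order of vertices given by $\varphi$. For $X\subseteq V$, the ordered graph $G[X]$ has vertex set $X$, the edges of $G$ with both ends in $X$, and the ordering $\varphi|_X$. For an ordered graph $H$, an ordered graph $G$ is $H$-free if $H$ is not isomorphic to $G[X]$ for any $X\subseteq V$. An instance of the Ordered Graph List-3-Coloring Problem is a pair $(G,L)$ of an ordered graph $G$ and a map $L:V(G)\to 2^{\{1,2,3\}}$, and the question is whether $G$ admits a map $c:V(G)\to\{1,2,3\}$ with $c(v)\in L(v)$ for every $v\in V(G)$ and $c(u)\neq c(v)$ for every $uv\in E(G)$. **Theorem.** Let $H$ be a fixed ordered graph with at most one edge. Then the Ordered Graph List-3-Coloring Problem restricted to $H$-free ordered graphs is solvable in polynomial time. That is, there are a Turing machine and a polynomial $p$ (both depending only on $H$) such that, for every instance $(G,L)$ with $G$ an $H$-free ordered graph, the machine started on the word of length $m=|V(G)|(|V(G)|+1)$ that records, for each vertex $u$, the list $L(u)$ and, for each vertex $v$, whether $uv\in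 E(G)$ and whether $\varphi(u)<\varphi(v)$, halts after at most $p(m)$ steps and correctly answers whether $G$ admits such a map $c$. -/

import Mathlib

/-- An ordered graph with vertex set `V`: a simple graph together with an injective function
from its vertex set to the reals. -/
structure OrderedGraph (V : Type*) where
  /-- the underlying graph -/
  graph : SimpleGraph V
  /-- the ordering -/
  ord : V → ℝ
  ord_injective : Function.Injective ord

namespace OrderedGraph

/-- Isomorphism of ordered graphs: a bijection that preserves and reflects both the order and
the adjacency of vertices. -/
def Isomorphic {V' V : Type*} (G' : OrderedGraph V') (G : OrderedGraph V) : Prop :=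
  ∃ f : V' ≃ V, ∀ v w : V',
    (G'.ord v < G'.ord w ↔ G.ord (f v) < G.ord (f w)) ∧
    (G'.graph.Adj v w ↔ G.graph.Adj (f v) (f w))

/-- The ordered graph `G[X]` induced by a set `X` of vertices. -/
def induce {V : Type*} (G : OrderedGraph V) (X : Set V) : OrderedGraph X where
  graph := G.graph.induce X
  ord := fun x => G.ord x
  ord_injective := G.ord_injective.comp Subtype.val_injective

/-- `H` is an induced (ordered) subgraph of `G`. -/
def IsInducedSubgraph {W V : Type*} (H : OrderedGraph W) (G : OrderedGraph V) : Prop :=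
  ∃ X : Set V, Isomorphic H (G.induce X)

/-- `G` is `H`-free. -/
def Free {V W : Type*} (G : OrderedGraph V) (H : OrderedGraph W) : Prop :=
  ¬ H.IsInducedSubgraph G

/-- `G` admits an `L`-coloring, for a `3`-list-assignment `L`: a proper coloring
with colors from `Fin 3` in which each vertex gets a color from its list. -/
def ListColorable {V : Type*} (G : OrderedGraph V) (L : V → Finset (Fin 3)) : Prop :=
  ∃ c : V → Fin 3, (∀ u v, G.graph.Adj u v → c u ≠ c v) ∧ ∀ v, c v ∈ L v

end OrderedGraph

/-- An instance `(G, L)` of the Ordered Graph List-3-Coloring Problem. The vertices of an input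
are labelled `0, …, n - 1`; the labels are unrelated to the ordering of the graph. -/
structure ListThreeInstance where
  /-- the number of vertices -/
  n : ℕ
  /-- the ordered graph -/
  G : OrderedGraph (Fin n)
  /-- the list assignment -/
  L : Fin n → Finset (Fin 3)

namespace ListThreeInstance

/-- The input alphabet: a symbol is either a list of colors or a pair of bits. -/
abbrev Symbol : Type := Finset (Fin 3) ⊕ (Bool × Bool)

open Classical in
/-- The input word of an instance. For each vertex `i` it contains the list of `i`, followed by
one symbol for each vertex `j`, which records whether `i` and `j` are adjacent and whether `i`
precedes `j` in the ordering. The word of an instance with `n` vertices has length `n * (n + 1)`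
and determines the graph, the lists, and the order relation on the vertices. -/
noncomputable def encode (I : ListThreeInstance) : List Symbol :=
  (List.finRange I.n).flatMap fun i =>
    Sum.inl (I.L i) :: (List.finRange I.n).map fun j =>
      Sum.inr (decide (I.G.graph.Adj i j), decide (I.G.ord i < I.G.ord j))

end ListThreeInstance

open Classical in
/-- The decision problem `P` on the set `α` of instances, presented to a machine as words over the
finite alphabet `Γ`, is solvable in polynomial time: one multi-stack Turing machine halts on the
word of every instance with the answer to `P` as output, within a number of steps that is bounded
by one polynomial in the length of the word. -/
def SolvableInPolyTime {α Γ : Type} [Fintype Γ] (encode : α → List Γ) (P : α → Prop) : Prop :=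
  Nonempty (Turing.TM2ComputableInPolyTime encode Computability.encodeBool
    (fun a => decide (P a)))

/-- The Ordered Graph List-3-Coloring Problem restricted to `H`-free ordered graphs is
solvable in polynomial time. -/
def OrderedListThreeColoringPolyTime {W : Type*} (H : OrderedGraph W) : Prop :=
  SolvableInPolyTime
    (fun I : {I : ListThreeInstance // I.G.Free H} => I.1.encode)
    (fun I => I.1.G.ListColorable I.1.L)

/-!
Fix `k = |V(H)|`. Suppose that an `H`-free ordered graph is 3-colored, color class by color class,
by scanning the vertices in increasing order, and that for each color the first `k` and the last
`k` vertices of its class are guessed in advance. A vertex that gets the color `i` is compared only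
with these guessed vertices and with the `k` vertices that were given the color `i` last. This
partial test is enough: if the first conflict is an edge `ab` with both ends colored `i`, then the
guessed vertices are all different from `a` and `b`, so that `k` of them lie before `a` and `k` lie
after `b`, and the `k` vertices in the window at the time of `b` lie between `a` and `b`. These `3k`
vertices are independent and not adjacent to `a` or `b`: for the guessed vertices this is tested,
and for the window it holds because `ab` is the first conflict. The argument needs only that the
guessed vertices lie where they should and are independent, not that they really are the ends of the
color class. Such a configuration contains every ordered graph with `k` vertices and at most one
edge (`OrderedGraph.isInducedSubgraph_of_edge`). Hence a coloring exists if and only if there is a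
run of `n` transitions of a system whose states are tuples of `9k + 1` vertices
(`ListThreeInstance.exists_reach_of_listColorable`, `ListThreeInstance.listColorable_of_sequence`).
Along a run each new vertex must come after the previous one in the ordering, so `n` transitions
color all vertices, and no bookkeeping of the set of colored vertices is needed.

There are polynomially many states, and the states that can be reached in `p` transitions are
tabulated for `p = 0, …, n` (`StackProg.acts_allTransitions`, `StackProg.acts_decider`). What a
transition does depends only on boundedly many symbols of the input. The machine for this is written
in a small structured language for programs on stacks, which is compiled to multi-stack machines
(`StackProg.solvableInPolyTime`); numbers are kept in unary as heights of stacks, so that reading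
the symbol at a computed position of the input or of the table is a loop that pops a counter, and
time bounds are polynomials because the nesting of the loops depends on `k` only
(`StackProg.solvableInPolyTime_of_reach`).
-/

/-! ### A structured language for programs on stacks -/

/-- Structured programs over stacks indexed by `K`, all with the alphabet `Γ`, and a finite control
with states `σ`. -/
inductive StackProg (K Γ σ : Type)
  | push (k : K) (f : σ → Γ)
  | pop (k : K) (f : σ → Option Γ → σ)
  | load (f : σ → σ)
  | seq (p q : StackProg K Γ σ)
  | ite (b : σ → Bool) (p q : StackProg K Γ σ)
  | loop (b : σ → Bool) (p : StackProg K Γ σ)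

namespace StackProg

variable {K Γ σ : Type}

/-- `Exec p c c' t`: the program `p` takes the control state and the stacks `c` to `c'`, and its
compiled form needs exactly `t` machine steps for this. -/
inductive Exec [DecidableEq K] :
    StackProg K Γ σ → σ × (K → List Γ) → σ × (K → List Γ) → ℕ → Prop
  | push (k f s S) : Exec (push k f) (s, S) (s, Function.update S k (f s :: S k)) 1
  | pop (k f s S) :
      Exec (pop k f) (s, S) (f s (S k).head?, Function.update S k (S k).tail) 1
  | load (f s S) : Exec (load f) (s, S) (f s, S) 1
  | seq {p q c c' c'' t t'} (hp : Exec p c c' t) (hq : Exec q c' c'' t') :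
      Exec (seq p q) c c'' (t + t')
  | ite_true {b p q c c' t} (hb : b c.1 = true) (hp : Exec p c c' t) :
      Exec (ite b p q) c c' (1 + t)
  | ite_false {b p q c c' t} (hb : b c.1 = false) (hq : Exec q c c' t) :
      Exec (ite b p q) c c' (1 + t)
  | loop_false {b p c} (hb : b c.1 = false) : Exec (loop b p) c c 1
  | loop_true {b p c c' c'' t t'} (hb : b c.1 = true) (hp : Exec p c c' t)
      (hl : Exec (loop b p) c' c'' t') : Exec (loop b p) c c'' (1 + t + t')

/-! ### Compilation to multi-stack machines -/

/-- The labels of the compiled program: one for each instruction and each test. -/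
def Pos : StackProg K Γ σ → Type
  | push _ _ | pop _ _ | load _ => Unit
  | seq p q => Pos p ⊕ Pos q
  | ite _ p q => Unit ⊕ (Pos p ⊕ Pos q)
  | loop _ p => Unit ⊕ Pos p

theorem finite_pos : ∀ p : StackProg K Γ σ, Finite p.Pos
  | push _ _ | pop _ _ | load _ => inferInstanceAs (Finite Unit)
  | seq p q => by
    have := finite_pos p
    have := finite_pos q
    exact inferInstanceAs (Finite (Pos p ⊕ Pos q))
  | ite _ p q => by
    have := finite_pos p
    have := finite_pos q
    exact inferInstanceAs (Finite (Unit ⊕ (Pos p ⊕ Pos q)))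
  | loop _ p => by
    have := finite_pos p
    exact inferInstanceAs (Finite (Unit ⊕ Pos p))

/-- The label at which the compiled program starts. -/
def entry : (p : StackProg K Γ σ) → p.Pos
  | push _ _ | pop _ _ | load _ => ()
  | seq p _ => Sum.inl (entry p)
  | ite _ _ _ => Sum.inl ()
  | loop _ _ => Sum.inl ()

/-- The alphabets of the stacks of a compiled program: the output stack `none` carries Booleans,
the stacks of the program carry `Γ`. -/
abbrev Alphabet (K Γ : Type) : Option K → Type
  | none => Bool
  | some _ => Γ

/-- The statements of the compiled program, when its labels are embedded by `emb` in the labels of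
a machine and control passes to `exit` at the end. -/
def code {Λ : Type} : (p : StackProg K Γ σ) → (p.Pos → Λ) → Λ → p.Pos →
    Turing.TM2.Stmt (Alphabet K Γ) Λ σ
  | push k f, _, exit, _ => .push (some k) f (.goto fun _ => exit)
  | pop k f, _, exit, _ => .pop (some k) f (.goto fun _ => exit)
  | load f, _, exit, _ => .load f (.goto fun _ => exit)
  | seq p q, emb, _exit, .inl l => code p (fun x => emb (.inl x)) (emb (.inr (entry q))) l
  | seq _ q, emb, exit, .inr l => code q (fun x => emb (.inr x)) exit l
  | ite b p q, emb, _exit, .inl _ => .branch b (.goto fun _ => emb (.inr (.inl (entry p))))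
      (.goto fun _ => emb (.inr (.inr (entry q))))
  | ite _ p _, emb, exit, .inr (.inl l) => code p (fun x => emb (.inr (.inl x))) exit l
  | ite _ _ q, emb, exit, .inr (.inr l) => code q (fun x => emb (.inr (.inr x))) exit l
  | loop b p, emb, exit, .inl _ =>
      .branch b (.goto fun _ => emb (.inr (entry p))) (.goto fun _ => exit)
  | loop _ p, emb, _exit, .inr l => code p (fun x => emb (.inr x)) (emb (.inl ())) l

/-- The stacks of the machine when the program has the stacks `S` and there is no output yet. -/
def liftStacks (S : K → List Γ) : ∀ k : Option K, List (Alphabet K Γ k)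
  | none => []
  | some k => S k

theorem liftStacks_update [DecidableEq K] (S : K → List Γ) (k : K) (l : List Γ) :
    Function.update (liftStacks S) (some k) l = liftStacks (Function.update S k l) := by
  funext k'
  rcases k' with _ | k'
  · simp [liftStacks]
  · by_cases h : k' = k
    · subst h
      simp [liftStacks]
    · rw [Function.update_of_ne (by simpa using h)]
      simp [liftStacks, Function.update_of_ne h]

/-- Simulation: a machine that contains the compiled program passes from its entry to its exit
label in as many steps as `Exec` counts. -/
theorem Exec.iterate_step [DecidableEq K] {Λ : Type}
    {M : Λ → Turing.TM2.Stmt (Alphabet K Γ) Λ σ}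
    {p : StackProg K Γ σ} {c c' : σ × (K → List Γ)} {t : ℕ} (h : Exec p c c' t) :
    ∀ (emb : p.Pos → Λ) (exit : Λ), (∀ l, M (emb l) = p.code emb exit l) →
      (flip bind (Turing.TM2.step M))^[t]
        (some ⟨some (emb p.entry), c.1, liftStacks c.2⟩) =
        some ⟨some exit, c'.1, liftStacks c'.2⟩ := by
  induction h with
  | push k f s S =>
    intro emb exit hM
    simp [flip, Turing.TM2.step, hM, code, liftStacks_update, liftStacks]
  | pop k f s S =>
    intro emb exit hM
    simp [flip, Turing.TM2.step, hM, code, liftStacks_update, liftStacks]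
  | load f s S =>
    intro emb exit hM
    simp [flip, Turing.TM2.step, hM, code]
  | @seq p q c c' c'' t t' _ _ ihp ihq =>
    intro emb exit hM
    rw [add_comm, Function.iterate_add_apply]
    refine (congrArg _ (ihp (fun x => emb (.inl x)) (emb (.inr (entry q)))
      fun l => hM (.inl l))).trans ?_
    exact ihq (fun x => emb (.inr x)) exit fun l => hM (.inr l)
  | @ite_true b p q c c' t hb _ ih =>
    intro emb exit hM
    rw [add_comm, Function.iterate_add_apply]
    refine (congrArg _ ?_).trans
      (ih (fun x => emb (.inr (.inl x))) exit fun l => hM (.inr (.inl l)))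
    have := hM (.inl ())
    simp [flip, Turing.TM2.step, entry, this, code, hb]
  | @ite_false b p q c c' t hb _ ih =>
    intro emb exit hM
    rw [add_comm, Function.iterate_add_apply]
    refine (congrArg _ ?_).trans
      (ih (fun x => emb (.inr (.inr x))) exit fun l => hM (.inr (.inr l)))
    have := hM (.inl ())
    simp [flip, Turing.TM2.step, entry, this, code, hb]
  | @loop_false b p c hb =>
    intro emb exit hM
    have := hM (.inl ())
    simp [flip, Turing.TM2.step, entry, this, code, hb]
  | @loop_true b p c c' c'' t t' hb _ _ ihp ihl =>
    intro emb exit hM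
    rw [add_comm, Function.iterate_add_apply, add_comm 1 t, Function.iterate_add_apply]
    refine (congrArg _ ?_).trans (ihl emb exit hM)
    refine (congrArg _ ?_).trans
      (ihp (fun x => emb (.inr x)) (emb (.inl ())) fun l => hM (.inr l))
    have := hM (.inl ())
    simp [flip, Turing.TM2.step, entry, this, code, hb]

/-- The machine that runs `p` and then puts the bit `out` of the control state on the output
stack. Control states are reset at the end, since a halting configuration must carry the initial
state. -/
noncomputable def toFinTM2 [Fintype K] [DecidableEq K] [Fintype Γ] [Fintype σ]
    (p : StackProg K Γ σ) (inp : K) (s₀ : σ) (out : σ → Bool) : Turing.FinTM2 :=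
  have : Fintype p.Pos := @Fintype.ofFinite _ p.finite_pos
  { K := Option K
    k₀ := some inp
    k₁ := none
    Γ := Alphabet K Γ
    Λ := Option p.Pos
    main := some p.entry
    σ := σ
    initialState := s₀
    Γk₀Fin := inferInstanceAs (Fintype Γ)
    m := fun l => match l with
      | none => .push none out (.load (fun _ => s₀) .halt)
      | some l => p.code some none l }

/-- A program that decides `P` and leaves all its stacks empty within polynomially many steps
yields polynomial-time solvability. -/
theorem solvableInPolyTime [Fintype K] [DecidableEq K] [Fintype Γ] [Fintype σ] {α : Type}
    {encode : α → List Γ} {P : α → Prop} (p : StackProg K Γ σ) (inp : K) (s₀ : σ)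
    (out : σ → Bool) (time : Polynomial ℕ)
    (h : ∀ a, ∃ t ≤ time.eval (encode a).length, ∃ s,
      Exec p (s₀, Function.update (fun _ => []) inp (encode a)) (s, fun _ => []) t ∧
        (out s = true ↔ P a)) :
    SolvableInPolyTime encode P := by
  classical
  choose t ht s hs hout using h
  refine ⟨{
    tm := p.toFinTM2 inp s₀ out
    inputAlphabet := Equiv.refl Γ
    outputAlphabet := Equiv.refl Bool
    time := time + 1
    outputsFun := fun a => {
      steps := 1 + t a
      evals_in_steps := ?_
      steps_le_m := ?_ } }⟩
  · have h₁ := (hs a).iterate_step (M := (p.toFinTM2 inp s₀ out).m) some none (fun _ => rfl)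
    rw [Function.iterate_add_apply]
    have h₂ : Turing.initList (p.toFinTM2 inp s₀ out)
        (List.map (Equiv.refl Γ).invFun (encode a)) =
        ⟨some (some p.entry), s₀,
          liftStacks (Function.update (fun _ => []) inp (encode a))⟩ := by
      unfold Turing.initList
      congr 1
      funext k
      rcases k with _ | k
      · rfl
      · by_cases hk : k = inp
        · subst hk
          simp [toFinTM2, liftStacks]
          rfl
        · simp [toFinTM2, liftStacks, hk]
    have h₃ : Turing.haltList (p.toFinTM2 inp s₀ out)
        (List.map (Equiv.refl Bool).invFun (Computability.encodeBool (decide (P a)))) =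
        ⟨none, s₀, Function.update (liftStacks fun _ => []) none [out (s a)]⟩ := by
      unfold Turing.haltList
      congr 1
      funext k
      rcases k with _ | k
      · have : out (s a) = decide (P a) := by
          rw [Bool.eq_iff_iff]
          simpa using hout a
        simp [toFinTM2, Computability.encodeBool, this]
        rfl
      · have hk : (some k : Option K) ≠ none := by simp
        exact (Function.update_of_ne hk _ (liftStacks fun _ => [])).symm
    rw [h₂]
    refine (congrArg _ h₁).trans ?_
    refine Eq.trans ?_ (congrArg some h₃.symm)
    rfl
  · have := ht a
    simp
    omega

section Runs

variable {K Γ ρ σ : Type} [DecidableEq K]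

/-! ### Loops that empty a stack -/

/-- `Runs p c c' B`: the program `p` takes `c` to `c'` within at most `B` steps. -/
def Runs (p : StackProg K Γ σ) (c c' : σ × (K → List Γ)) (B : ℕ) : Prop :=
  ∃ t ≤ B, Exec p c c' t

theorem Runs.mono {p : StackProg K Γ σ} {c c' : σ × (K → List Γ)} {B B' : ℕ}
    (h : Runs p c c' B) (hB : B ≤ B') : Runs p c c' B' :=
  let ⟨t, ht, he⟩ := h
  ⟨t, ht.trans hB, he⟩

theorem Runs.congr {p : StackProg K Γ σ} {c c' c'' : σ × (K → List Γ)} {B : ℕ}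
    (h : Runs p c c' B) (hc : c' = c'') : Runs p c c'' B :=
  hc ▸ h

theorem Runs.seq {p q : StackProg K Γ σ} {c c' c'' : σ × (K → List Γ)} {B B' : ℕ}
    (hp : Runs p c c' B) (hq : Runs q c' c'' B') : Runs (seq p q) c c'' (B + B') :=
  let ⟨t, ht, he⟩ := hp
  let ⟨t', ht', he'⟩ := hq
  ⟨t + t', Nat.add_le_add ht ht', .seq he he'⟩

theorem runs_push (k : K) (f : σ → Γ) (s : σ) (S : K → List Γ) :
    Runs (push k f) (s, S) (s, Function.update S k (f s :: S k)) 1 :=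
  ⟨1, le_rfl, .push k f s S⟩

theorem runs_pop (k : K) (f : σ → Option Γ → σ) (s : σ) (S : K → List Γ) :
    Runs (pop k f) (s, S) (f s (S k).head?, Function.update S k (S k).tail) 1 :=
  ⟨1, le_rfl, .pop k f s S⟩

theorem runs_load (f : σ → σ) (s : σ) (S : K → List Γ) :
    Runs (load f : StackProg K Γ σ) (s, S) (f s, S) 1 :=
  ⟨1, le_rfl, .load f s S⟩

theorem runs_ite {b : σ → Bool} {p q : StackProg K Γ σ} {c c' : σ × (K → List Γ)} {B : ℕ}
    (h : Runs (if b c.1 = true then p else q) c c' B) : Runs (ite b p q) c c' (1 + B) := by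
  obtain ⟨t, ht, he⟩ := h
  refine ⟨1 + t, by omega, ?_⟩
  split_ifs at he with hb
  · exact .ite_true hb he
  · exact .ite_false (by simpa using hb) he

/-- The program that does nothing. -/
def skip : StackProg K Γ σ := load id

theorem runs_skip (c : σ × (K → List Γ)) : Runs skip c c 1 :=
  runs_load id c.1 c.2

/-- Moves the top of the stack `A` into the buffer, the first component of the control state. -/
def popBuf (A : K) : StackProg K Γ (Option Γ × ρ) := pop A fun s o => (o, s.2)

/-- Pushes the symbol in the buffer, or `d` if there is none, on the stack `B`. -/
def pushBuf (d : Γ) (B : K) : StackProg K Γ (Option Γ × ρ) := push B fun s => s.1.getD d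

/-- Pops the stack `A` until it is empty, and runs `body` after each popped symbol. -/
def drain (A : K) (body : StackProg K Γ (Option Γ × ρ)) : StackProg K Γ (Option Γ × ρ) :=
  seq (popBuf A) (loop (fun s => s.1.isSome) (seq body (popBuf A)))

/-- The invariant rule for `drain`: `I l` describes the control state and the stacks at the time
when `l` is what remains of the stack `A`. -/
theorem runs_drain {A : K} {body : StackProg K Γ (Option Γ × ρ)} {B : ℕ}
    (I : List Γ → ρ → (K → List Γ) → Prop) (hA : ∀ l r S, I l r S → S A = l)
    (hstep : ∀ g l r S, I (g :: l) r S → ∃ o r' S',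
      Runs body ((some g, r), Function.update S A l) ((o, r'), S') B ∧ I l r' S') :
    ∀ l r S o, I l r S → ∃ r' S',
      Runs (drain A body) ((o, r), S) ((none, r'), S') (l.length * (B + 2) + 2) ∧ I [] r' S' := by
  suffices key : ∀ l r S o, I l r S → ∃ r' S' t₁ t₂ o₁ S₁, t₁ + t₂ ≤ l.length * (B + 2) + 2 ∧
      Exec (popBuf A) ((o, r), S) ((o₁, r), S₁) t₁ ∧
      Exec (loop (fun s => s.1.isSome) (seq body (popBuf A))) ((o₁, r), S₁)
        ((none, r'), S') t₂ ∧ I [] r' S' by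
    intro l r S o h
    obtain ⟨r', S', t₁, t₂, o₁, S₁, ht, h₁, h₂, h₃⟩ := key l r S o h
    exact ⟨r', S', ⟨_, ht, .seq h₁ h₂⟩, h₃⟩
  intro l
  induction l with
  | nil =>
    intro r S o h
    have h₀ := hA _ _ _ h
    refine ⟨r, S, 1, 1, none, S, by simp, ?_, .loop_false rfl, h⟩
    have := Exec.pop (Γ := Γ) A (fun (s : Option Γ × ρ) o => (o, s.2)) (o, r) S
    rwa [h₀, List.head?_nil, List.tail_nil, ← h₀, Function.update_eq_self] at this
  | cons g l ih =>
    intro r S o h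
    have h₀ := hA _ _ _ h
    obtain ⟨o', r', S', ⟨t, ht, hb⟩, h'⟩ := hstep g l r S h
    obtain ⟨r'', S'', t₁, t₂, o₁, S₁, ht', h₁, h₂, h₃⟩ := ih r' S' o' h'
    refine ⟨r'', S'', 1, 1 + (t + t₁) + t₂, some g, Function.update S A l, ?_, ?_,
      .loop_true rfl (.seq hb h₁) h₂, h₃⟩
    · simp only [List.length_cons, Nat.add_mul, Nat.one_mul]
      omega
    · have := Exec.pop (Γ := Γ) A (fun (s : Option Γ × ρ) o => (o, s.2)) (o, r) S
      rwa [h₀] at this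

/-- Pours the stack `A` on the stack `B`, in reverse. -/
def pour (d : Γ) (A B : K) : StackProg K Γ (Option Γ × ρ) := drain A (pushBuf d B)

theorem runs_pour {d : Γ} {A B : K} (hAB : A ≠ B) (s : Option Γ × ρ) (S : K → List Γ) :
    Runs (pour d A B) (s, S)
      ((none, s.2), Function.update (Function.update S A []) B ((S A).reverse ++ S B))
      ((S A).length * 3 + 2) := by
  obtain ⟨r', S', h, rfl, hA, hB, hS⟩ := runs_drain (A := A) (body := pushBuf d B) (B := 1)
    (fun l r T => r = s.2 ∧ T A = l ∧ l.reverse ++ T B = (S A).reverse ++ S B ∧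
      ∀ k, k ≠ A → k ≠ B → T k = S k)
    (fun l r T h => h.2.1)
    (fun g l r T h => by
      obtain ⟨hr, hA, hB, hT⟩ := h
      refine ⟨_, _, _, runs_push _ _ _ _, hr, ?_, ?_, fun k hkA hkB => ?_⟩
      · simp [hAB]
      · simpa [hAB.symm] using hB
      · simp [hkA, hkB, hT])
    (S A) s.2 S s.1 ⟨rfl, rfl, rfl, fun _ _ _ => rfl⟩
  refine h.congr (Prod.ext rfl (funext fun k => ?_))
  by_cases hkB : k = B
  · subst hkB
    simpa using hB
  · by_cases hkA : k = A
    · subst hkA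
      simp [hkB, hA]
    · simp [hkA, hkB, hS]

/-- Pushes, for each symbol on the stack `A`, one symbol `d` on the stack `B`. The stack `X`
serves as an intermediate store and is empty before and after. -/
def dup (d : Γ) (X A B : K) : StackProg K Γ (Option Γ × ρ) :=
  seq (drain A (seq (pushBuf d X) (push B fun _ => d))) (pour d X A)

theorem runs_dup {d : Γ} {X A B : K} (hXA : X ≠ A) (hXB : X ≠ B) (hAB : A ≠ B)
    (s : Option Γ × ρ) (S : K → List Γ) (hX : S X = []) :
    Runs (dup d X A B) (s, S)
      ((none, s.2), Function.update S B (List.replicate (S A).length d ++ S B))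
      ((S A).length * 7 + 4) := by
  obtain ⟨r', S', h, rfl, hA, hX', hB, hS⟩ := runs_drain (A := A)
    (body := seq (pushBuf d X) (push B fun _ => d)) (B := 1 + 1)
    (fun l r T => r = s.2 ∧ T A = l ∧ l.reverse ++ T X = (S A).reverse ∧
      List.replicate l.length d ++ T B = List.replicate (S A).length d ++ S B ∧
      ∀ k, k ≠ A → k ≠ B → k ≠ X → T k = S k)
    (fun l r T h => h.2.1)
    (fun g l r T h => by
      obtain ⟨hr, hA, hX, hB, hT⟩ := h
      refine ⟨_, _, _, (runs_push _ _ _ _).seq (runs_push _ _ _ _), hr, ?_, ?_, ?_,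
        fun k hkA hkB hkX => ?_⟩
      · simp [hAB, hXA.symm]
      · simpa [hXA, hXB] using hX
      · rw [← hB]
        simp only [List.length_cons, List.replicate_succ', Function.update_self,
          Function.update_of_ne hAB.symm, Function.update_of_ne hXB.symm]
        simp
      · simp [hkA, hkB, hkX, hT])
    (S A) s.2 S s.1 ⟨rfl, rfl, by simp [hX], rfl, fun _ _ _ _ => rfl⟩
  refine Runs.mono (h.seq ?_ (B' := (S A).length * 3 + 2)) (by omega)
  have h₂ := runs_pour (d := d) hXA (none, s.2) S'
  simp only [List.reverse_nil, List.nil_append, List.length_nil, List.replicate_zero] at hX' hB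
  rw [hX', hA] at h₂
  rw [List.length_reverse] at h₂
  refine h₂.congr (Prod.ext rfl (funext fun k => ?_))
  by_cases hkB : k = B
  · subst hkB
    simp [hAB.symm, hXB.symm, hB]
  · by_cases hkA : k = A
    · subst hkA
      simp [hAB]
    · by_cases hkX : k = X
      · subst hkX
        simp [hXA, hXB, hX]
      · simp [hkA, hkB, hkX, hS]

/-- Moves as many symbols from the stack `A` to the stack `X` as there are on the counter `C`; if
the symbols on `A` run out, it goes on with the symbols that `pad` provides, if any. -/
def seek (d : Γ) (C X A : K) (pad : Option Γ) : StackProg K Γ (Option Γ × ρ) :=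
  drain C (seq (popBuf A) (ite (fun s => s.1.isSome) (pushBuf d X)
    (match pad with
      | none => skip
      | some b => push X fun _ => b)))

theorem runs_seek {d : Γ} {C X A : K} (hCX : C ≠ X) (hCA : C ≠ A) (hXA : X ≠ A)
    (pad : Option Γ) (s : Option Γ × ρ) (S : K → List Γ) (hX : S X = []) :
    ∃ S', Runs (seek d C X A pad) (s, S) ((none, s.2), S') ((S C).length * 5 + 2) ∧
      S' C = [] ∧ S' X = ((S A).take (S C).length ++
        pad.elim [] (List.replicate ((S C).length - (S A).length))).reverse ∧
      S' A = (S A).drop (S C).length ∧ ∀ k, k ≠ C → k ≠ A → k ≠ X → S' k = S k := by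
  obtain ⟨r', S', h, rfl, hC, ⟨c, hc, hX', hA⟩, hS⟩ := runs_drain (A := C)
    (body := seq (popBuf A) (ite (fun s => s.1.isSome) (pushBuf d X)
      (match pad with
        | none => skip
        | some b => push X fun _ => b))) (B := 1 + (1 + 1))
    (fun l r T => r = s.2 ∧ T C = l ∧ (∃ c, l.length + c = (S C).length ∧
      T X = ((S A).take c ++ pad.elim [] (List.replicate (c - (S A).length))).reverse ∧
      T A = (S A).drop c) ∧ ∀ k, k ≠ C → k ≠ A → k ≠ X → T k = S k)
    (fun l r T h => h.2.1)
    (fun g l r T h => by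
      obtain ⟨hr, hC, ⟨c, hc, hX, hA⟩, hT⟩ := h
      simp only [List.length_cons] at hc
      have hTA : Function.update T C l A = T A := Function.update_of_ne hCA.symm _ _
      have hTX : Function.update T C l X = T X := Function.update_of_ne hCX.symm _ _
      rcases hd : (S A).drop c with _ | ⟨a, L⟩
      · have hlen : (S A).length ≤ c := List.drop_eq_nil_iff.mp hd
        have hA' : (S A).drop (c + 1) = [] := List.drop_eq_nil_iff.mpr (by omega)
        have hpop : Runs (popBuf (ρ := ρ) A) ((some g, r), Function.update T C l)
            ((none, r), Function.update T C l) 1 :=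
          (runs_pop _ _ _ _).congr (by
            simp only [hTA, hA, hd, List.head?_nil, List.tail_nil]
            rw [← hd, ← hA, ← hTA, Function.update_eq_self])
        rcases pad with _ | b
        · refine ⟨_, _, _, hpop.seq (runs_ite (B := 1) (runs_skip _)), hr, ?_,
            ⟨c + 1, by omega, ?_, ?_⟩, fun k hkC hkA hkX => ?_⟩
          · simp
          · rw [hTX, hX, List.take_of_length_le hlen, List.take_of_length_le (by omega)]
            rfl
          · rw [hTA, hA, hd, hA']
          · simp [hkC, hT _ hkC hkA hkX]
        · refine ⟨_, _, _, hpop.seq (runs_ite (B := 1) (runs_push _ _ _ _)), hr, ?_,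
            ⟨c + 1, by omega, ?_, ?_⟩, fun k hkC hkA hkX => ?_⟩
          · simp [hCX]
          · rw [Function.update_self, hTX, hX, List.take_of_length_le hlen,
              List.take_of_length_le (by omega), Nat.succ_sub hlen]
            simp [List.replicate_succ']
          · rw [Function.update_of_ne hXA.symm, hTA, hA, hd, hA']
          · simp [hkC, hkX, hT _ hkC hkA hkX]
      · have hlt : c < (S A).length := by
          by_contra hcon
          rw [List.drop_eq_nil_iff.mpr (by omega)] at hd
          simp at hd
        have hL : L = (S A).drop (c + 1) := by
          rw [← List.tail_drop, hd, List.tail_cons]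
        have ha : (S A)[c] = a := by
          rw [List.drop_eq_getElem_cons hlt] at hd
          exact (List.cons.inj hd).1
        have hpop : Runs (popBuf (ρ := ρ) A) ((some g, r), Function.update T C l)
            ((some a, r), Function.update (Function.update T C l) A L) 1 :=
          (runs_pop _ _ _ _).congr (by
            simp only [hTA, hA, hd, List.head?_cons, List.tail_cons])
        refine ⟨_, _, _, hpop.seq (runs_ite (B := 1) (runs_push _ _ _ _)), hr, ?_,
          ⟨c + 1, by omega, ?_, ?_⟩, fun k hkC hkA hkX => ?_⟩
        · simp [hCX, hCA]
        · rw [Function.update_self, Function.update_of_ne hXA, hTX, hX,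
            List.take_succ_eq_append_getElem hlt, ha, Nat.sub_eq_zero_of_le hlt.le,
            Nat.sub_eq_zero_of_le (show c + 1 ≤ (S A).length from hlt)]
          rcases pad with _ | b <;> simp
        · rw [Function.update_of_ne hXA.symm, Function.update_self, hL]
        · simp [hkC, hkA, hkX, hT _ hkC hkA hkX])
    (S C) s.2 S s.1 ⟨rfl, rfl, ⟨0, by simp, by cases pad <;> simp [hX], by simp⟩,
      fun _ _ _ _ => rfl⟩
  simp only [List.length_nil, Nat.zero_add] at hc
  subst hc
  exact ⟨S', h, hC, hX', hA, hS⟩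

/-- Reads the symbol of the stack `A` at the depth given by the counter `C`, which is emptied, and
updates the control state by `f`. -/
def readAt (d : Γ) (C X A : K) (f : ρ → Option Γ → ρ) : StackProg K Γ (Option Γ × ρ) :=
  seq (seek d C X A none) (seq (popBuf A) (seq (ite (fun s => s.1.isSome) (pushBuf d A) skip)
    (seq (load fun s => (s.1, f s.2 s.1)) (pour d X A))))

theorem runs_readAt {d : Γ} {C X A : K} (hCX : C ≠ X) (hCA : C ≠ A) (hXA : X ≠ A)
    (f : ρ → Option Γ → ρ) (s : Option Γ × ρ) (S : K → List Γ) (hX : S X = []) :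
    Runs (readAt d C X A f) (s, S)
      ((none, f s.2 (S A)[(S C).length]?), Function.update S C []) ((S C).length * 8 + 8) := by
  obtain ⟨S', h, hC, hX', hA, hS⟩ := runs_seek (d := d) hCX hCA hXA none s S hX
  simp only [Option.elim_none, List.append_nil] at hX'
  have hrest : Runs (seq (popBuf A) (ite (fun s => s.1.isSome) (pushBuf d A) skip))
      ((none, s.2), S') (((S A)[(S C).length]?, s.2), S') (1 + (1 + 1)) := by
    refine (runs_pop _ _ _ _).seq (runs_ite ?_)
    have hget : (S' A).head? = (S A)[(S C).length]? := by rw [hA, List.head?_drop]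
    rw [← hget]
    rcases hl : S' A with _ | ⟨a, L⟩
    · simp only [List.head?_nil, List.tail_nil]
      have hS' : Function.update S' A [] = S' := by rw [← hl, Function.update_eq_self]
      rw [hS']
      exact runs_skip _
    · simp only [List.head?_cons, List.tail_cons]
      refine (runs_push _ _ _ _).congr ?_
      simp [← hl]
  obtain ⟨t₁, ht₁, h₁⟩ := h
  obtain ⟨t₂, ht₂, h₂⟩ := hrest
  cases h₂ with
  | seq hp hi =>
  have hpour := runs_pour (d := d) hXA ((S A)[(S C).length]?, f s.2 (S A)[(S C).length]?) S'
  refine Runs.mono (Runs.seq ⟨t₁, ht₁, h₁⟩ (Runs.seq ⟨_, le_rfl, hp⟩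
    (Runs.seq ⟨_, le_rfl, hi⟩ (Runs.seq (runs_load _ _ _) (hpour.congr ?_))))) ?_
  · refine Prod.ext rfl (funext fun k => ?_)
    by_cases hkA : k = A
    · subst hkA
      simp [hX', hA, hCA.symm]
    · by_cases hkX : k = X
      · subst hkX
        simp [hXA, hCX.symm, hX]
      · by_cases hkC : k = C
        · subst hkC
          simp [hC, hCX, hCA]
        · simp [hkA, hkX, hkC, hS]
  · have : (S' X).length ≤ (S C).length := by
      rw [hX']
      simp
    omega

/-- The list `l` with the entry at `c` replaced by `a`, filled up with `b` if it is too short. -/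
def setPad (b a : Γ) (l : List Γ) (c : ℕ) : List Γ :=
  l.take c ++ List.replicate (c - l.length) b ++ a :: l.drop (c + 1)

theorem length_setPad_le (b a : Γ) (l : List Γ) (c : ℕ) :
    (setPad b a l c).length ≤ max l.length (c + 1) := by
  simp [setPad]
  omega

theorem getD_setPad (b a : Γ) (l : List Γ) (c i : ℕ) :
    (setPad b a l c).getD i b = if i = c then a else l.getD i b := by
  have hlen : (l.take c ++
      List.replicate (c - l.length) b).length = c := by
    simp
    omega
  simp only [setPad, List.getD_eq_getElem?_getD]
  rcases lt_trichotomy i c with hi | hi | hi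
  · rw [List.getElem?_append_left (by omega), if_neg hi.ne]
    by_cases hiA : i < l.length
    · rw [List.getElem?_append_left (by simp; omega), List.getElem?_take_of_lt hi]
    · rw [List.getElem?_append_right (by simp; omega), List.getElem?_replicate,
        List.getElem?_eq_none (l := l) (by omega)]
      split_ifs <;> rfl
  · subst hi
    rw [List.getElem?_append_right (by omega), hlen]
    simp
  · rw [List.getElem?_append_right (by omega), hlen, if_neg hi.ne',
      List.getElem?_cons, if_neg (by omega), List.getElem?_drop]
    congr 2
    omega

/-- Writes the symbol `a` into the stack `A` at the depth given by the counter `C`, which is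
emptied; a stack that is too short is first filled up with the symbol `b`. -/
def writeAt (d b a : Γ) (C X A : K) : StackProg K Γ (Option Γ × ρ) :=
  seq (seek d C X A (some b)) (seq (popBuf A) (seq (push A fun _ => a) (pour d X A)))

theorem runs_writeAt {d b a : Γ} {C X A : K} (hCX : C ≠ X) (hCA : C ≠ A) (hXA : X ≠ A)
    (s : Option Γ × ρ) (S : K → List Γ) (hX : S X = []) :
    Runs (writeAt d b a C X A) (s, S)
      ((none, s.2), Function.update (Function.update S C []) A (setPad b a (S A) (S C).length))
      ((S C).length * 8 + 6) := by
  obtain ⟨S', h, hC, hX', hA, hS⟩ := runs_seek (d := d) hCX hCA hXA (some b) s S hX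
  simp only [Option.elim_some] at hX'
  refine Runs.mono (h.seq ((runs_pop _ _ _ _).seq ((runs_push _ _ _ _).seq
    ((runs_pour hXA _ _).congr (Prod.ext rfl (funext fun k => ?_)))))) ?_
  · by_cases hkA : k = A
    · subst hkA
      simp [setPad, hX', hA, hXA]
    · by_cases hkX : k = X
      · subst hkX
        simp [hXA, hCX.symm, hX]
      · by_cases hkC : k = C
        · subst hkC
          simp [hC, hCX, hCA]
        · simp [hkA, hkX, hkC, hS]
  · have : (S' X).length = (S C).length := by
      rw [hX']
      simp
    simp only [Function.update_of_ne hXA, this]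
    omega

end Runs

end StackProg

/-! ### Polynomially bounded functions -/

/-- `f` is bounded by a polynomial with natural coefficients. -/
def PolyBounded (f : ℕ → ℕ) : Prop := ∃ P : Polynomial ℕ, ∀ n, f n ≤ P.eval n

namespace PolyBounded

theorem const (c : ℕ) : PolyBounded fun _ => c := ⟨Polynomial.C c, fun n => by simp⟩

theorem id : PolyBounded fun n => n := ⟨Polynomial.X, fun n => by simp⟩

theorem add {f g : ℕ → ℕ} (hf : PolyBounded f) (hg : PolyBounded g) :
    PolyBounded fun n => f n + g n :=
  let ⟨P, hP⟩ := hf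
  let ⟨Q, hQ⟩ := hg
  ⟨P + Q, fun n => by simpa using Nat.add_le_add (hP n) (hQ n)⟩

theorem mul {f g : ℕ → ℕ} (hf : PolyBounded f) (hg : PolyBounded g) :
    PolyBounded fun n => f n * g n :=
  let ⟨P, hP⟩ := hf
  let ⟨Q, hQ⟩ := hg
  ⟨P * Q, fun n => by simpa using Nat.mul_le_mul (hP n) (hQ n)⟩

theorem pow {f : ℕ → ℕ} (hf : PolyBounded f) (k : ℕ) : PolyBounded fun n => f n ^ k :=
  let ⟨P, hP⟩ := hf
  ⟨P ^ k, fun n => by simpa using Nat.pow_le_pow_left (hP n) k⟩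

end PolyBounded

namespace StackProg

open ListThreeInstance (Symbol)

/-! ### Counter registers -/

/-- The stacks of a machine with the loop variables `V`: the input word, an intermediate store, a
counter, a second counter, the number `n + 1` in unary, a table, and for each loop variable its
value in unary and the number of iterations that remain. -/
inductive Reg (V : Type)
  | inp | aux | cnt | tmp | base | tbl
  | idx (a : V)
  | rem (a : V)
  deriving DecidableEq

theorem finite_reg (V : Type) [Finite V] : Finite (Reg V) :=
  Finite.of_surjective (α := Fin 6 ⊕ V ⊕ V)
    (fun
      | .inl i => ![Reg.inp, .aux, .cnt, .tmp, .base, .tbl] i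
      | .inr (.inl a) => .idx a
      | .inr (.inr a) => .rem a)
    (by
      rintro (_ | _ | _ | _ | _ | _ | a | a)
      · exact ⟨.inl 0, rfl⟩
      · exact ⟨.inl 1, rfl⟩
      · exact ⟨.inl 2, rfl⟩
      · exact ⟨.inl 3, rfl⟩
      · exact ⟨.inl 4, rfl⟩
      · exact ⟨.inl 5, rfl⟩
      · exact ⟨.inr (.inl a), rfl⟩
      · exact ⟨.inr (.inr a), rfl⟩)

/-- The unary digit, and the entry of the table that stands for `true`. -/
def mark : Symbol := Sum.inr (true, true)

/-- The entry of the table that stands for `false`. -/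
def blank : Symbol := Sum.inr (false, false)

variable {V ρ : Type} [DecidableEq V]

/-- The store with the input word `w`, the table `L`, the number `c` on the counter, and the values
`x` and remaining iterations `y` of the loop variables. -/
def store (w : List Symbol) (n : ℕ) (x y : V → ℕ) (L : List Symbol) (c : ℕ) :
    Reg V → List Symbol
  | .inp => w
  | .aux => []
  | .cnt => List.replicate c mark
  | .tmp => []
  | .base => List.replicate (n + 1) mark
  | .tbl => L
  | .idx a => List.replicate (x a) mark
  | .rem a => List.replicate (y a) mark

section Acts

variable {w : List Symbol} {n : ℕ} {x y : V → ℕ} {L : List Symbol} {c : ℕ}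

theorem update_store_cnt (c' : ℕ) :
    Function.update (store w n x y L c) .cnt (List.replicate c' mark) =
      store w n x y L c' := by
  funext k
  cases k <;> simp [store]

theorem update_store_tbl (L' : List Symbol) :
    Function.update (store w n x y L c) .tbl L' = store w n x y L' c := by
  funext k
  cases k <;> simp [store]

theorem update_store_idx (a : V) (t : ℕ) :
    Function.update (store w n x y L c) (.idx a) (List.replicate t mark) =
      store w n (Function.update x a t) y L c := by
  funext k
  rcases k with _ | _ | _ | _ | _ | _ | b | b <;> try simp [store]
  by_cases h : b = a
  · subst h
    simp
  · simp [h, store]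

theorem update_store_rem (a : V) (t : ℕ) :
    Function.update (store w n x y L c) (.rem a) (List.replicate t mark) =
      store w n x (Function.update y a t) L c := by
  funext k
  rcases k with _ | _ | _ | _ | _ | _ | b | b <;> try simp [store]
  by_cases h : b = a
  · subst h
    simp
  · simp [h, store]

/-- `Acts p S S' r r' B`: whatever the buffer holds, `p` takes the stacks `S` and the control state
`r` to `S'` and `r'` within at most `B` steps. -/
def Acts (p : StackProg (Reg V) Symbol (Option Symbol × ρ)) (S S' : Reg V → List Symbol)
    (r r' : ρ) (B : ℕ) : Prop :=
  ∀ o, ∃ o', Runs p ((o, r), S) ((o', r'), S') B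

variable {p q : StackProg (Reg V) Symbol (Option Symbol × ρ)} {S S' S'' : Reg V → List Symbol}
  {r r' r'' : ρ} {B B' : ℕ}

theorem Acts.mono (h : Acts p S S' r r' B) (hB : B ≤ B') : Acts p S S' r r' B' := fun o =>
  let ⟨o', ho⟩ := h o
  ⟨o', ho.mono hB⟩

theorem Acts.congr (h : Acts p S S' r r' B) (hr : r' = r'') : Acts p S S' r r'' B :=
  hr ▸ h

theorem Acts.seq (hp : Acts p S S' r r' B) (hq : Acts q S' S'' r' r'' B') :
    Acts (seq p q) S S'' r r'' (B + B') := fun o =>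
  let ⟨o', ho⟩ := hp o
  let ⟨o'', ho'⟩ := hq o'
  ⟨o'', ho.seq ho'⟩

theorem acts_skip (S : Reg V → List Symbol) (r : ρ) : Acts skip S S r r 1 :=
  fun o => ⟨o, runs_skip _⟩

theorem acts_ite {b : ρ → Bool} (h : Acts (if b r = true then p else q) S S' r r' B) :
    Acts (ite (fun s => b s.2) p q) S S' r r' (1 + B) := fun o =>
  let ⟨o', ho⟩ := h o
  ⟨o', runs_ite ho⟩

/-- Applies `f` to the control state, leaving the buffer alone. -/
def act (f : ρ → ρ) : StackProg (Reg V) Symbol (Option Symbol × ρ) := load fun s => (s.1, f s.2)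

theorem acts_act (f : ρ → ρ) (S : Reg V → List Symbol) (r : ρ) : Acts (act f) S S r (f r) 1 :=
  fun o => ⟨o, runs_load _ _ _⟩

/-! ### Index arithmetic -/

/-- Operations on the counter: multiplication by `n + 1`, addition of a loop variable, and
increment. -/
inductive IdxOp (V : Type)
  | mul
  | add (a : V)
  | inc

/-- The effect of an operation on the counter. -/
def IdxOp.eval (n : ℕ) (x : V → ℕ) (c : ℕ) : IdxOp V → ℕ
  | mul => c * (n + 1)
  | add a => c + x a
  | inc => c + 1

/-- The program of an operation on the counter. -/
def IdxOp.prog : IdxOp V → StackProg (Reg V) Symbol (Option Symbol × ρ)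
  | mul => .seq (pour mark .cnt .tmp) (drain .tmp (dup mark .aux .base .cnt))
  | add a => dup mark .aux (.idx a) .cnt
  | inc => push .cnt fun _ => mark

theorem acts_mul (r : ρ) :
    Acts (IdxOp.mul.prog : StackProg (Reg V) Symbol (Option Symbol × ρ))
      (store w n x y L c) (store w n x y L (c * (n + 1))) r r
      (c * 3 + 2 + (c * ((n + 1) * 7 + 4 + 2) + 2)) := by
  intro o
  have h₁ := runs_pour (d := mark) (A := Reg.cnt) (B := .tmp) (by simp) (o, r)
    (store w n x y L c)
  obtain ⟨r', S', h₂, rfl, i, hi, rfl⟩ := runs_drain (A := Reg.tmp)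
    (body := dup mark .aux .base .cnt) (B := (n + 1) * 7 + 4)
    (fun l s T => s = r ∧ ∃ i, i + l.length = c ∧
      T = Function.update (store w n x y L (i * (n + 1))) .tmp l)
    (fun l s T h => by
      obtain ⟨-, i, -, rfl⟩ := h
      simp)
    (fun g l s T h => by
      obtain ⟨rfl, i, hi, rfl⟩ := h
      have h := runs_dup (d := mark) (X := Reg.aux) (A := .base) (B := .cnt) (by simp) (by simp)
        (by simp) (some g, s)
        (Function.update (store w n x y L (i * (n + 1))) .tmp l) (by simp [store])
      simp only [List.length_cons] at hi
      refine ⟨none, s, _, ?_, rfl, i + 1, by omega, rfl⟩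
      rw [Function.update_idem]
      have hlen : (Function.update (store w n x y L (i * (n + 1))) .tmp l .base).length =
          n + 1 := by
        simp [store]
      have hadd : List.replicate (n + 1) mark ++
          Function.update (store w n x y L (i * (n + 1))) .tmp l .cnt =
          List.replicate ((i + 1) * (n + 1)) mark := by
        simp [store, List.replicate_append_replicate, Nat.add_mul, Nat.add_comm]
      rw [hlen, hadd, Function.update_comm (by simp), update_store_cnt] at h
      exact h)
    (List.replicate c mark) r (Function.update (store w n x y L 0) .tmp (List.replicate c mark))
    none ⟨rfl, 0, by simp, by simp⟩
  simp only [List.length_nil, Nat.add_zero] at hi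
  subst hi
  refine ⟨none, Runs.mono ((h₁.congr ?_).seq (h₂.congr (Prod.ext rfl ?_))) ?_⟩
  · refine Prod.ext rfl (funext fun k => ?_)
    cases k <;> simp [store]
  · exact (Function.update_eq_self_iff).2 rfl
  · simp [store]

theorem acts_add (a : V) (r : ρ) :
    Acts ((IdxOp.add a).prog : StackProg (Reg V) Symbol (Option Symbol × ρ))
      (store w n x y L c) (store w n x y L (c + x a)) r r (x a * 7 + 4) := fun o => by
  have h := runs_dup (d := mark) (X := Reg.aux) (A := .idx a) (B := .cnt) (by simp) (by simp)
    (by simp) (o, r) (store w n x y L c) rfl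
  have hlen : (store w n x y L c (.idx a)).length = x a := by simp [store]
  rw [hlen] at h
  have hadd : List.replicate (x a) mark ++ store w n x y L c .cnt =
      List.replicate (c + x a) mark := by
    simp [store, List.replicate_append_replicate, Nat.add_comm]
  rw [hadd, update_store_cnt] at h
  exact ⟨none, h⟩

theorem acts_inc (r : ρ) :
    Acts (IdxOp.inc.prog : StackProg (Reg V) Symbol (Option Symbol × ρ))
      (store w n x y L c) (store w n x y L (c + 1)) r r 1 := fun o => by
  exact ⟨o, (runs_push _ _ _ _).congr (Prod.ext rfl (update_store_cnt (c := c) (c + 1)))⟩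

/-- Runs the programs in the list one after the other. -/
def seqs {K Γ σ : Type} : List (StackProg K Γ σ) → StackProg K Γ σ
  | [] => skip
  | p :: ps => seq p (seqs ps)

/-- The program that performs the given operations on the counter in turn. -/
def index (ops : List (IdxOp V)) : StackProg (Reg V) Symbol (Option Symbol × ρ) :=
  seqs (ops.map IdxOp.prog)

theorem acts_index (ops : List (IdxOp V)) : ∀ {f : ℕ → ℕ}, PolyBounded f →
    ∃ h g, PolyBounded h ∧ PolyBounded g ∧
      ∀ (w : List Symbol) (n : ℕ) (x y : V → ℕ) (L : List Symbol) (c : ℕ) (r : ρ),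
      (∀ a, x a ≤ n) → c ≤ f n →
      Acts (index ops) (store w n x y L c)
        (store w n x y L (ops.foldl (IdxOp.eval n x) c)) r r (h n) ∧
        ops.foldl (IdxOp.eval n x) c ≤ g n := by
  induction ops with
  | nil => exact fun {f} hf => ⟨_, f, .const 1, hf,
      fun w n x y L c r _ hc => ⟨acts_skip _ _, hc⟩⟩
  | cons op ops ih =>
    intro f hf
    obtain ⟨g, hg, hgf⟩ : ∃ g, PolyBounded g ∧ ∀ (n : ℕ) (x : V → ℕ) (c : ℕ),
        (∀ a, x a ≤ n) → c ≤ f n → op.eval n x c ≤ g n := by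
      cases op with
      | mul => exact ⟨_, hf.mul (PolyBounded.id.add (.const 1)), fun n x c _ hc =>
          Nat.mul_le_mul_right _ hc⟩
      | add a => exact ⟨_, hf.add .id, fun n x c hx hc => Nat.add_le_add hc (hx a)⟩
      | inc => exact ⟨_, hf.add (.const 1), fun n x c _ hc => Nat.add_le_add_right hc 1⟩
    obtain ⟨t, ht, htb⟩ : ∃ t, PolyBounded t ∧ ∀ (w : List Symbol) (n : ℕ) (x y : V → ℕ)
        (L : List Symbol) (c : ℕ) (r : ρ), (∀ a, x a ≤ n) → c ≤ f n →
        Acts op.prog (store w n x y L c) (store w n x y L (op.eval n x c)) r r (t n) := by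
      cases op with
      | mul =>
        refine ⟨fun n => f n * 3 + 2 + (f n * ((n + 1) * 7 + 4 + 2) + 2), ?_,
          fun w n x y L c r _ hc => (acts_mul r).mono (by beta_reduce; gcongr)⟩
        exact ((hf.mul (.const 3)).add (.const 2)).add ((hf.mul
          ((((PolyBounded.id.add (.const 1)).mul (.const 7)).add (.const 4)).add (.const 2))).add
          (.const 2))
      | add a =>
        refine ⟨fun n => n * 7 + 4, (PolyBounded.id.mul (.const 7)).add (.const 4),
          fun w n x y L c r hx _ => (acts_add a r).mono ?_⟩
        have := hx a
        beta_reduce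
        gcongr
      | inc => exact ⟨_, .const 1, fun w n x y L c r _ _ => acts_inc r⟩
    obtain ⟨h, g', hh, hg', hb⟩ := ih hg
    exact ⟨_, g', ht.add hh, hg', fun w n x y L c r hx hc =>
      have hb' := hb w n x y L _ r hx (hgf n x c hx hc)
      ⟨(htb w n x y L c r hx hc).seq hb'.1, hb'.2⟩⟩

/-! ### Bounded loops -/

/-- Runs `body` for the values `0, …, n` of the loop variable `a`. -/
def forLoop (a : V) (body : StackProg (Reg V) Symbol (Option Symbol × ρ)) :
    StackProg (Reg V) Symbol (Option Symbol × ρ) :=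
  seq (dup mark .aux .base (.rem a))
    (seq (drain (.rem a) (seq body (push (.idx a) fun _ => mark))) (drain (.idx a) skip))

/-- The time for a loop whose body takes `B` steps. -/
def forTime (n B : ℕ) : ℕ :=
  (n + 1) * 7 + 4 + ((n + 1) * (B + 1 + 2) + 2 + ((n + 1) * (1 + 2) + 2))

theorem runs_drain_skip {K Γ ρ : Type} [DecidableEq K] (A : K) (s : Option Γ × ρ)
    (S : K → List Γ) :
    Runs (drain A skip) (s, S) ((none, s.2), Function.update S A [])
      ((S A).length * (1 + 2) + 2) := by
  obtain ⟨r', S', h, rfl, hA, hS⟩ := runs_drain (A := A) (body := skip) (B := 1)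
    (fun l r T => r = s.2 ∧ T A = l ∧ ∀ k, k ≠ A → T k = S k)
    (fun l r T h => h.2.1)
    (fun g l r T h => ⟨_, _, _, runs_skip _, h.1, by simp,
      fun k hk => by simp [hk, h.2.2 k hk]⟩)
    (S A) s.2 S s.1 ⟨rfl, rfl, fun _ _ => rfl⟩
  refine h.congr (Prod.ext rfl (funext fun k => ?_))
  by_cases hk : k = A
  · subst hk
    simp [hA]
  · simp [hk, hS]

theorem acts_forLoop {a : V} {body : StackProg (Reg V) Symbol (Option Symbol × ρ)}
    (hx : x a = 0) (hy : y a = 0) (I : ℕ → ρ → List Symbol → Prop)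
    (hbody : ∀ t ≤ n, ∀ r L, I t r L → ∃ r' L',
      Acts body (store w n (Function.update x a t) (Function.update y a (n - t)) L 0)
        (store w n (Function.update x a t) (Function.update y a (n - t)) L' 0) r r' B ∧
      I (t + 1) r' L')
    (h₀ : I 0 r L) :
    ∃ r' L', Acts (forLoop a body) (store w n x y L 0) (store w n x y L' 0) r r'
      (forTime n B) ∧ I (n + 1) r' L' := by
  have key := runs_drain (A := Reg.rem a)
    (body := seq body (push (.idx a) fun _ => mark)) (B := B + 1)
    (fun l s T => ∃ t L', t + l.length = n + 1 ∧ l = List.replicate (n + 1 - t) mark ∧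
      T = store w n (Function.update x a t) (Function.update y a (n + 1 - t)) L' 0 ∧ I t s L')
    (fun l s T h => by
      obtain ⟨t, L', -, rfl, rfl, -⟩ := h
      simp [store])
    (fun g l s T h => by
      obtain ⟨t, L', ht, hl, rfl, hI⟩ := h
      simp only [List.length_cons] at ht
      obtain ⟨r', L'', hb, hI'⟩ := hbody t (by omega) s L' hI
      obtain ⟨o', hb⟩ := hb (some g)
      have hl' : l = List.replicate (n - t) mark := by
        rw [show n + 1 - t = n - t + 1 by omega, List.replicate_succ] at hl
        exact (List.cons.inj hl).2
      refine ⟨o', r', _, ?_, t + 1, L'', by omega, by rw [hl']; congr 1; omega, rfl, hI'⟩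
      rw [hl', update_store_rem, Function.update_idem]
      refine hb.seq ((runs_push _ _ _ _).congr (Prod.ext rfl ?_))
      have : n + 1 - (t + 1) = n - t := by omega
      rw [this]
      have h := update_store_idx (w := w) (n := n) (x := Function.update x a t)
        (y := Function.update y a (n - t)) (L := L'') (c := 0) a (t + 1)
      rw [Function.update_idem] at h
      rw [← h]
      simp [store, List.replicate_succ])
    (List.replicate (n + 1) mark) r
    (store w n (Function.update x a 0) (Function.update y a (n + 1)) L 0)
  have hx' : Function.update x a 0 = x := by rw [← hx, Function.update_eq_self]
  have hy' : Function.update y a 0 = y := by rw [← hy, Function.update_eq_self]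
  obtain ⟨r', S', h₁, t, L', ht, -, rfl, hI⟩ := key none
    ⟨0, L, by simp, rfl, rfl, h₀⟩
  simp only [List.length_nil, Nat.add_zero] at ht
  subst ht
  refine ⟨r', L', fun o => ⟨none, ?_⟩, hI⟩
  have h₂ := runs_dup (d := mark) (X := Reg.aux) (A := .base) (B := .rem a) (by simp) (by simp)
    (by simp) (o, r) (store w n x y L 0) rfl
  have h₃ := runs_drain_skip (Reg.idx a) (none, r')
    (store w n (Function.update x a (n + 1)) (Function.update y a (n + 1 - (n + 1))) L' 0)
  refine Runs.mono ((h₂.congr (c'' := ((none, r), store w n (Function.update x a 0)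
    (Function.update y a (n + 1)) L 0)) (Prod.ext rfl ?_)).seq
    (h₁.seq (h₃.congr (c'' := ((none, r'), store w n x y L' 0)) (Prod.ext rfl ?_)))) ?_
  · rw [hx', ← update_store_rem]
    simp [store, hy]
  · have h := update_store_idx (w := w) (n := n) (x := Function.update x a (n + 1))
      (y := Function.update y a (n + 1 - (n + 1))) (L := L') (c := 0) a 0
    rw [Nat.sub_self, Function.update_idem, hx', hy'] at h
    rw [Nat.sub_self, hy']
    exact h
  · simp [store, forTime]

/-- Nested loops over the variables in the list. -/
def loops (vs : List V) (body : StackProg (Reg V) Symbol (Option Symbol × ρ)) :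
    StackProg (Reg V) Symbol (Option Symbol × ρ) :=
  vs.foldr forLoop body

/-- The valuations that nested loops run through, in this order. -/
def tuples (n : ℕ) : List V → (V → ℕ) → List (V → ℕ)
  | [], x => [x]
  | a :: vs, x => (List.range (n + 1)).flatMap fun t => tuples n vs (Function.update x a t)

theorem mem_tuples {vs : List V} (hvs : vs.Nodup) {x₀ x : V → ℕ} :
    x ∈ tuples n vs x₀ ↔ (∀ a ∈ vs, x a ≤ n) ∧ ∀ a, a ∉ vs → x a = x₀ a := by
  induction vs generalizing x₀ with
  | nil => simp [tuples, funext_iff]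
  | cons b vs ih =>
    rw [List.nodup_cons] at hvs
    simp only [tuples, List.mem_flatMap, List.mem_range, ih hvs.2, List.mem_cons, not_or,
      forall_eq_or_imp]
    constructor
    · rintro ⟨t, ht, h₁, h₂⟩
      have := h₂ b hvs.1
      rw [Function.update_self] at this
      refine ⟨⟨by omega, h₁⟩, fun a ha => ?_⟩
      rw [h₂ a ha.2, Function.update_of_ne ha.1]
    · rintro ⟨⟨h₁, h₂⟩, h₃⟩
      refine ⟨x b, by omega, h₂, fun a ha => ?_⟩
      by_cases hab : a = b
      · subst hab
        simp
      · rw [Function.update_of_ne hab, h₃ a ⟨hab, ha⟩]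

/-- The invariant rule for nested loops: `J l` holds when the valuations in `l` are done. -/
theorem acts_loops {body : StackProg (Reg V) Symbol (Option Symbol × ρ)} (vs : List V)
    (hvs : vs.Nodup) (J : List (V → ℕ) → ρ → List Symbol → Prop) {x₀ : V → ℕ}
    (hx : ∀ a ∈ vs, x₀ a = 0)
    (hbody : ∀ x ∈ tuples n vs x₀, ∀ y l r L, J l r L → ∃ r' L',
      Acts body (store w n x y L 0) (store w n x y L' 0) r r' B ∧ J (l ++ [x]) r' L') :
    ∀ y l r L, (∀ a ∈ vs, y a = 0) → J l r L → ∃ r' L',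
      Acts (loops vs body) (store w n x₀ y L 0) (store w n x₀ y L' 0) r r'
        ((forTime n)^[vs.length] B) ∧ J (l ++ tuples n vs x₀) r' L' := by
  induction vs generalizing x₀ with
  | nil => exact fun y l r L _ => hbody x₀ (by simp [tuples]) y l r L
  | cons a vs ih =>
    intro y l r L hy h
    rw [List.nodup_cons] at hvs
    have hne : ∀ b ∈ vs, b ≠ a := fun b hb hba => hvs.1 (hba ▸ hb)
    obtain ⟨r', L', h₁, h₂⟩ := acts_forLoop (w := w) (n := n) (x := x₀) (y := y) (r := r) (L := L)
      (B := (forTime n)^[vs.length] B) (a := a) (body := loops vs body) (hx a (by simp))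
      (hy a (by simp))
      (fun t r L => J (l ++ (List.range t).flatMap fun t =>
        tuples n vs (Function.update x₀ a t)) r L)
      (fun t ht r L hJ => by
        obtain ⟨r', L', h₁, h₂⟩ := ih hvs.2 (x₀ := Function.update x₀ a t)
          (fun b hb => by rw [Function.update_of_ne (hne b hb), hx b (by simp [hb])])
          (fun x hx => hbody x (by
            simp only [tuples, List.mem_flatMap, List.mem_range]
            exact ⟨t, by omega, hx⟩))
          (Function.update y a (n - t)) _ r L
          (fun b hb => by rw [Function.update_of_ne (hne b hb), hy b (by simp [hb])]) hJ
        refine ⟨r', L', h₁, ?_⟩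
        rw [List.range_succ, List.flatMap_append, ← List.append_assoc]
        simpa using h₂)
      (by simpa using h)
    refine ⟨r', L', ?_, h₂⟩
    rw [List.length_cons, Function.iterate_succ_apply']
    exact h₁

theorem polyBounded_forTime_iterate {B : ℕ → ℕ} (hB : PolyBounded B) (k : ℕ) :
    PolyBounded fun n => (forTime n)^[k] (B n) := by
  induction k with
  | zero => exact hB
  | succ k ih =>
    simp only [Function.iterate_succ_apply', forTime]
    have h₁ : PolyBounded fun n => n + 1 := PolyBounded.id.add (.const 1)
    exact ((h₁.mul (.const 7)).add (.const 4)).add (((h₁.mul ((ih.add (.const 1)).add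
      (.const 2))).add (.const 2)).add ((h₁.mul (.const (1 + 2))).add (.const 2)))

end Acts

/-! ### Transition systems on tuples of indices -/

variable {κ : Type}

/-- What a transition may depend on: for the indices held by the slots `κ` and by a new slot, the
symbols of the input at the corresponding places. -/
abbrev View (κ : Type) : Type :=
  (Option κ → Option κ → Option Symbol) × (Option κ → Option Symbol)

/-- The view of the input word `w` from the indices `e`. The word consists of blocks of length
`n + 1`, so the second component has the first symbols of the blocks `e a`, and the first component
the symbols that the block `e a` has for the index `e b`. The value `n` stands for an empty slot. -/
def view (w : List Symbol) (n : ℕ) (e : Option κ → ℕ) : View κ :=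
  (fun a b => w[e a * (n + 1) + e b + 1]?, fun a => w[e a * (n + 1)]?)

/-- A transition rule: it may be applied when `cond` holds, and the slot `k` then receives the
index in the slot `dst k`, where `none` is the new slot. -/
structure Rule (κ : Type) where
  /-- the condition on the view -/
  cond : View κ → Bool
  /-- the slots from which the new contents are taken -/
  dst : κ → Option κ

/-- `Reach w n rules p s`: there is a run of `p` transitions that ends in `s`. It may start
anywhere, and in each step an arbitrary index is put into the new slot. -/
def Reach (w : List Symbol) (n : ℕ) (rules : List (Rule κ)) : ℕ → (κ → ℕ) → Prop
  | 0, _ => True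
  | p + 1, s => ∃ e : Option κ → ℕ, (∀ a, e a ≤ n) ∧ Reach w n rules p (fun k => e (some k)) ∧
      ∃ rule ∈ rules, rule.cond (view w n e) = true ∧ s = fun k => e (rule.dst k)

/-- The number with the leading digit `c` and the digits `s k` in base `n + 1`. -/
def keyCode (n : ℕ) (ks : List κ) (c : ℕ) (s : κ → ℕ) : ℕ :=
  ks.foldl (fun c k => c * (n + 1) + s k) c

theorem keyCode_lt {n : ℕ} {s : κ → ℕ} (hs : ∀ k, s k ≤ n) (ks : List κ) (c : ℕ) :
    keyCode n ks c s < (c + 1) * (n + 1) ^ ks.length := by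
  induction ks generalizing c with
  | nil => simp [keyCode]
  | cons k ks ih =>
    refine (ih _).trans_le ?_
    rw [List.length_cons, pow_succ', ← mul_assoc]
    refine Nat.mul_le_mul_right _ ?_
    have := hs k
    rw [Nat.add_mul]
    show c * (n + 1) + s k + 1 ≤ _
    omega

theorem keyCode_inj {n : ℕ} {s s' : κ → ℕ} (hs : ∀ k, s k ≤ n) (hs' : ∀ k, s' k ≤ n)
    (ks : List κ) {c c' : ℕ} (h : keyCode n ks c s = keyCode n ks c' s') :
    c = c' ∧ ∀ k ∈ ks, s k = s' k := by
  induction ks generalizing c c' with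
  | nil => exact ⟨h, by simp⟩
  | cons k ks ih =>
    obtain ⟨h₁, h₂⟩ := ih h
    beta_reduce at h₁
    have h₃ : s k < n + 1 := Nat.lt_succ_of_le (hs k)
    have h₄ : s' k < n + 1 := Nat.lt_succ_of_le (hs' k)
    have h₅ : s k = s' k := by
      have := congrArg (· % (n + 1)) h₁
      simpa [Nat.add_comm, Nat.add_mul_mod_self_right, Nat.mod_eq_of_lt, h₃, h₄] using this
    have h₆ : c = c' := by
      rw [h₅] at h₁
      exact Nat.eq_of_mul_eq_mul_right (Nat.succ_pos n) (Nat.add_right_cancel h₁)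
    exact ⟨h₆, by simpa [h₅] using h₂⟩

/-! ### The machine for a transition system -/

/-- The control state: the view collected so far, and three bits, which tell whether no transition
has been made, whether some state is reachable, and whether the present state is. -/
@[ext] structure Ctrl (κ : Type) where
  /-- the view collected so far -/
  view : View κ
  /-- no transition has been made yet -/
  first : Bool
  /-- some state is reachable -/
  acc : Bool
  /-- the present state is reachable -/
  live : Bool

theorem finite_ctrl (κ : Type) [Finite κ] : Finite (Ctrl κ) :=
  Finite.of_injective (β := View κ × Bool × Bool × Bool)
    (fun r => (r.view, r.first, r.acc, r.live)) fun r r' h => by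
      simp only [Prod.mk.injEq] at h
      exact Ctrl.ext h.1 h.2.1 h.2.2.1 h.2.2.2

section Acts

variable {V ρ : Type} [DecidableEq V] {w : List Symbol} {n : ℕ} {x y : V → ℕ} {L : List Symbol}

theorem acts_readInp (f : ρ → Option Symbol → ρ) (c : ℕ) (r : ρ) :
    Acts (readAt mark Reg.cnt .aux .inp f) (store w n x y L c) (store w n x y L 0) r
      (f r w[c]?) (c * 8 + 8) := fun o => by
  have h := runs_readAt (d := mark) (C := Reg.cnt) (X := .aux) (A := .inp) (by simp) (by simp)
    (by simp) f (o, r) (store w n x y L c) rfl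
  have hS := update_store_cnt (w := w) (n := n) (x := x) (y := y) (L := L) (c := c) 0
  have hc : (store w n x y L c .cnt).length = c := by simp [store]
  rw [List.replicate_zero] at hS
  rw [hS, hc] at h
  exact ⟨none, h⟩

theorem acts_readTbl (f : ρ → Option Symbol → ρ) (c : ℕ) (r : ρ) :
    Acts (readAt mark Reg.cnt .aux .tbl f) (store w n x y L c) (store w n x y L 0) r
      (f r L[c]?) (c * 8 + 8) := fun o => by
  have h := runs_readAt (d := mark) (C := Reg.cnt) (X := .aux) (A := .tbl) (by simp) (by simp)
    (by simp) f (o, r) (store w n x y L c) rfl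
  have hS := update_store_cnt (w := w) (n := n) (x := x) (y := y) (L := L) (c := c) 0
  have hc : (store w n x y L c .cnt).length = c := by simp [store]
  rw [List.replicate_zero] at hS
  rw [hS, hc] at h
  exact ⟨none, h⟩

theorem acts_writeTbl (c : ℕ) (r : ρ) :
    Acts (writeAt mark blank mark Reg.cnt .aux .tbl) (store w n x y L c)
      (store w n x y (setPad blank mark L c) 0) r r (c * 8 + 6) := fun o => by
  have h := runs_writeAt (d := mark) (b := blank) (a := mark) (C := Reg.cnt) (X := .aux)
    (A := .tbl) (by simp) (by simp) (by simp) (o, r) (store w n x y L c) rfl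
  have hS := update_store_cnt (w := w) (n := n) (x := x) (y := y) (L := L) (c := c) 0
  have hc : (store w n x y L c .cnt).length = c := by simp [store]
  rw [List.replicate_zero] at hS
  rw [hS, hc, update_store_tbl] at h
  exact ⟨none, h⟩

end Acts

section Machine

variable {κ : Type}

/-- The loop variables are the number `none` of transitions made, and the indices in the slots. -/
abbrev LoopVar (κ : Type) : Type := Option (Option κ)

/-- The programs of the machine. -/
abbrev MachineProg (κ : Type) : Type :=
  StackProg (Reg (LoopVar κ)) Symbol (Option Symbol × Ctrl κ)

theorem getD_blank_eq_mark (L : List Symbol) (i : ℕ) :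
    L.getD i blank = mark ↔ L[i]? = some mark := by
  rw [List.getD_eq_getElem?_getD]
  rcases L[i]? with _ | a
  · simp [blank, mark]
  · simp

section Keys

variable [Fintype κ]

/-- The enumeration of the slots that fixes the positions of states in the table. -/
noncomputable def slots (κ : Type) [Fintype κ] : List κ := Finset.univ.toList

/-- The operations that turn the counter `c` into `keyCode n (slots κ) c s`, where `s` is the tuple
of the indices in the slots `f`. -/
noncomputable def keyOps (f : κ → Option κ) : List (IdxOp (LoopVar κ)) :=
  (slots κ).flatMap fun k => [.mul, .add (some (f k))]

theorem foldl_keyOps (f : κ → Option κ) (n : ℕ) (x : LoopVar κ → ℕ) (c : ℕ) :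
    (keyOps f).foldl (IdxOp.eval n x) c = keyCode n (slots κ) c fun k => x (some (f k)) := by
  simp only [keyOps, keyCode]
  induction slots κ generalizing c with
  | nil => rfl
  | cons k ks ih => exact ih _

end Keys

variable [DecidableEq κ]

/-- Reads one symbol of the first component of the view. -/
noncomputable def readPair (q : Option κ × Option κ) : MachineProg κ :=
  seq (index [.add (some q.1), .mul, .add (some q.2), .inc])
    (readAt mark .cnt .aux .inp fun r o =>
      { r with view := (fun a b => if (a, b) = q then o else r.view.1 a b, r.view.2) })

/-- Reads one symbol of the second component of the view. -/
noncomputable def readHead (q : Option κ) : MachineProg κ :=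
  seq (index [.add (some q), .mul])
    (readAt mark .cnt .aux .inp fun r o =>
      { r with view := (r.view.1, fun a => if a = q then o else r.view.2 a) })

theorem acts_readPairs (l : List (Option κ × Option κ)) :
    ∃ h, PolyBounded h ∧ ∀ (w : List Symbol) (n : ℕ) (x y : LoopVar κ → ℕ) (L : List Symbol)
      (r : Ctrl κ), (∀ a, x a ≤ n) →
      Acts (seqs (l.map readPair)) (store w n x y L 0) (store w n x y L 0) r
        { r with view := (fun a b => if (a, b) ∈ l then (view w n fun a => x (some a)).1 a b
          else r.view.1 a b, r.view.2) } (h n) := by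
  induction l with
  | nil => exact ⟨_, .const 1, fun w n x y L r _ => (acts_skip _ _).congr (by simp)⟩
  | cons q l ih =>
    obtain ⟨h, hh, hb⟩ := ih
    obtain ⟨t, g, ht, hg, htb⟩ := acts_index (ρ := Ctrl κ)
      [.add (some q.1), .mul, .add (some q.2), .inc] (PolyBounded.const 0)
    refine ⟨_, (ht.add ((hg.mul (.const 8)).add (.const 8))).add hh, fun w n x y L r hx => ?_⟩
    have h₁ := htb w n x y L 0 r hx le_rfl
    have h₂ := (h₁.1.seq (acts_readInp (fun r o => { r with
      view := (fun a b => if (a, b) = q then o else r.view.1 a b, r.view.2) }) _ _)).seq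
      (hb w n x y L _ hx)
    have h₃ := h₂.mono (Nat.add_le_add_right (Nat.add_le_add_left
      (Nat.add_le_add_right (Nat.mul_le_mul_right 8 h₁.2) 8) _) _)
    refine h₃.congr (Ctrl.ext (Prod.ext (funext fun a => funext fun b => ?_) rfl) rfl rfl rfl)
    by_cases hl : (a, b) ∈ l
    · simp [hl]
    · by_cases hq : (a, b) = q
      · subst hq
        simp [hl, IdxOp.eval, view]
      · simp [hl, hq]

theorem acts_readHeads (l : List (Option κ)) :
    ∃ h, PolyBounded h ∧ ∀ (w : List Symbol) (n : ℕ) (x y : LoopVar κ → ℕ) (L : List Symbol)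
      (r : Ctrl κ), (∀ a, x a ≤ n) →
      Acts (seqs (l.map readHead)) (store w n x y L 0) (store w n x y L 0) r
        { r with view := (r.view.1, fun a => if a ∈ l then (view w n fun a => x (some a)).2 a
          else r.view.2 a) } (h n) := by
  induction l with
  | nil => exact ⟨_, .const 1, fun w n x y L r _ => (acts_skip _ _).congr (by simp)⟩
  | cons q l ih =>
    obtain ⟨h, hh, hb⟩ := ih
    obtain ⟨t, g, ht, hg, htb⟩ := acts_index (ρ := Ctrl κ)
      [.add (some q), .mul] (PolyBounded.const 0)
    refine ⟨_, (ht.add ((hg.mul (.const 8)).add (.const 8))).add hh, fun w n x y L r hx => ?_⟩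
    have h₁ := htb w n x y L 0 r hx le_rfl
    have h₂ := (h₁.1.seq (acts_readInp (fun r o => { r with
      view := (r.view.1, fun a => if a = q then o else r.view.2 a) }) _ _)).seq
      (hb w n x y L _ hx)
    have h₃ := h₂.mono (Nat.add_le_add_right (Nat.add_le_add_left
      (Nat.add_le_add_right (Nat.mul_le_mul_right 8 h₁.2) 8) _) _)
    refine h₃.congr (Ctrl.ext (Prod.ext rfl (funext fun a => ?_)) rfl rfl rfl)
    by_cases hl : a ∈ l
    · simp [hl]
    · by_cases hq : a = q
      · subst hq
        simp [hl, IdxOp.eval, view]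
      · simp [hl, hq]

variable [Fintype κ]

/-- Looks up whether the present state is reachable. -/
noncomputable def readLive : MachineProg κ :=
  seq (index (.add none :: keyOps some))
    (readAt mark .cnt .aux .tbl fun r o =>
      { r with
        acc := r.acc || (r.first || decide (o = some mark))
        live := r.first || decide (o = some mark) })

/-- Marks the state that a rule leads to, if the rule is applicable. -/
noncomputable def applyRule (rule : Rule κ) : MachineProg κ :=
  ite (fun s => (fun r : Ctrl κ => r.live && rule.cond r.view) s.2)
    (seq (index (.add none :: .inc :: keyOps rule.dst)) (writeAt mark blank mark .cnt .aux .tbl))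
    skip

/-- Reads the whole view. -/
noncomputable def readView : MachineProg κ :=
  seq (seqs ((Finset.univ.toList : List (Option κ × Option κ)).map readPair))
    (seqs ((Finset.univ.toList : List (Option κ)).map readHead))

/-- The body of the loops: all transitions from one state with one choice of the new index. -/
noncomputable def body (rules : List (Rule κ)) : MachineProg κ :=
  seq readView (seq readLive (seqs (rules.map applyRule)))

theorem acts_readLive :
    ∃ h, PolyBounded h ∧ ∀ (w : List Symbol) (n : ℕ) (x y : LoopVar κ → ℕ) (L : List Symbol)
      (r : Ctrl κ), (∀ a, x a ≤ n) → ∃ b : Bool,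
      (b = true ↔ r.first = true ∨
        L.getD (keyCode n (slots κ) (x none) fun k => x (some (some k))) blank = mark) ∧
      Acts readLive (store w n x y L 0) (store w n x y L 0) r
        { r with acc := r.acc || b, live := b } (h n) := by
  obtain ⟨t, g, ht, hg, htb⟩ := acts_index (ρ := Ctrl κ)
    (.add none :: keyOps (κ := κ) some) (PolyBounded.const 0)
  refine ⟨_, ht.add ((hg.mul (.const 8)).add (.const 8)), fun w n x y L r hx => ?_⟩
  have h₁ := htb w n x y L 0 r hx le_rfl
  rw [List.foldl_cons, foldl_keyOps, IdxOp.eval, Nat.zero_add] at h₁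
  refine ⟨r.first || decide
    (L[keyCode n (slots κ) (x none) fun k => x (some (some k))]? = some mark), ?_, ?_⟩
  · rw [getD_blank_eq_mark]
    simp
  · exact (h₁.1.seq (acts_readTbl _ _ _)).mono (Nat.add_le_add_left
      (Nat.add_le_add_right (Nat.mul_le_mul_right 8 h₁.2) 8) _)

/-- A bound for the length of the table. -/
noncomputable def tableBound (κ : Type) [Fintype κ] (n : ℕ) : ℕ :=
  (n + 2) * (n + 1) ^ (slots κ).length

theorem acts_applyRules (rules : List (Rule κ)) :
    ∃ h, PolyBounded h ∧ ∀ (w : List Symbol) (n : ℕ) (x y : LoopVar κ → ℕ) (L : List Symbol)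
      (r : Ctrl κ), (∀ a, x a ≤ n) → ∃ L',
      Acts (seqs (rules.map applyRule)) (store w n x y L 0) (store w n x y L' 0) r r (h n) ∧
      L'.length ≤ max L.length (tableBound κ n) ∧
      ∀ i, L'.getD i blank = mark ↔ L.getD i blank = mark ∨ (r.live = true ∧ ∃ rule ∈ rules,
        rule.cond r.view = true ∧
          i = keyCode n (slots κ) (x none + 1) fun k => x (some (rule.dst k))) := by
  induction rules with
  | nil => exact ⟨_, .const 1, fun w n x y L r _ => ⟨L, acts_skip _ _, by simp, by simp⟩⟩
  | cons rule rules ih =>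
    obtain ⟨h, hh, hb⟩ := ih
    obtain ⟨t, g, ht, hg, htb⟩ := acts_index (ρ := Ctrl κ)
      (.add none :: .inc :: keyOps rule.dst) (PolyBounded.const 0)
    refine ⟨_, ((PolyBounded.const 1).add ((ht.add ((hg.mul (.const 8)).add (.const 6))).add
      (.const 1))).add hh, fun w n x y L r hx => ?_⟩
    have h₁ := htb w n x y L 0 r hx le_rfl
    rw [List.foldl_cons, List.foldl_cons, foldl_keyOps, IdxOp.eval, IdxOp.eval,
      Nat.zero_add] at h₁
    have hlt := keyCode_lt (fun k => hx (some (rule.dst k))) (slots κ) (x none + 1)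
    by_cases hc : (r.live && rule.cond r.view) = true
    · obtain ⟨L', h₂, h₃, h₄⟩ := hb w n x y (setPad blank mark L
        (keyCode n (slots κ) (x none + 1) fun k => x (some (rule.dst k)))) r hx
      have hw := (h₁.1.seq (acts_writeTbl _ _)).mono (B' := t n + (g n * 8 + 6) + 1)
        (by have := h₁.2; omega)
      refine ⟨L', (acts_ite (b := fun r : Ctrl κ => r.live && rule.cond r.view)
        (by rw [if_pos hc]; exact hw)).seq h₂, h₃.trans ?_, fun i => ?_⟩
      · have h₅ : keyCode n (slots κ) (x none + 1) (fun k => x (some (rule.dst k))) + 1 ≤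
            tableBound κ n := by
          refine Nat.succ_le_of_lt (hlt.trans_le (Nat.mul_le_mul_right _ ?_))
          have := hx none
          omega
        have := length_setPad_le blank mark L
          (keyCode n (slots κ) (x none + 1) fun k => x (some (rule.dst k)))
        omega
      · rw [h₄, getD_setPad]
        rw [Bool.and_eq_true] at hc
        simp only [hc.1, true_and, List.mem_cons, exists_eq_or_imp, hc.2]
        split_ifs with hi <;> simp [hi]
    · obtain ⟨L', h₂, h₃, h₄⟩ := hb w n x y L r hx
      refine ⟨L', (acts_ite (b := fun r : Ctrl κ => r.live && rule.cond r.view)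
        (by rw [if_neg hc]; exact (acts_skip _ _).mono (by omega))).seq h₂, h₃, fun i => ?_⟩
      rw [h₄]
      rw [Bool.and_eq_true] at hc
      simp only [List.mem_cons, exists_eq_or_imp]
      tauto

theorem acts_readView :
    ∃ h, PolyBounded h ∧ ∀ (w : List Symbol) (n : ℕ) (x y : LoopVar κ → ℕ) (L : List Symbol)
      (r : Ctrl κ), (∀ a, x a ≤ n) →
      Acts readView (store w n x y L 0) (store w n x y L 0) r
        { r with view := view w n fun a => x (some a) } (h n) := by
  obtain ⟨h₁, hh₁, hb₁⟩ := acts_readPairs (Finset.univ.toList : List (Option κ × Option κ))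
  obtain ⟨h₂, hh₂, hb₂⟩ := acts_readHeads (Finset.univ.toList : List (Option κ))
  exact ⟨_, hh₁.add hh₂, fun w n x y L r hx =>
    ((hb₁ w n x y L r hx).seq (hb₂ w n x y L _ hx)).congr (by simp)⟩

theorem acts_body (rules : List (Rule κ)) :
    ∃ h, PolyBounded h ∧ ∀ (w : List Symbol) (n : ℕ) (x y : LoopVar κ → ℕ) (L : List Symbol)
      (r : Ctrl κ), (∀ a, x a ≤ n) → ∃ r' L',
      Acts (body rules) (store w n x y L 0) (store w n x y L' 0) r r' (h n) ∧
      r'.first = r.first ∧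
      (r'.acc = true ↔ r.acc = true ∨ r.first = true ∨
        L.getD (keyCode n (slots κ) (x none) fun k => x (some (some k))) blank = mark) ∧
      L'.length ≤ max L.length (tableBound κ n) ∧
      ∀ i, L'.getD i blank = mark ↔ L.getD i blank = mark ∨ ((r.first = true ∨
        L.getD (keyCode n (slots κ) (x none) fun k => x (some (some k))) blank = mark) ∧
        ∃ rule ∈ rules, rule.cond (view w n fun a => x (some a)) = true ∧
          i = keyCode n (slots κ) (x none + 1) fun k => x (some (rule.dst k))) := by
  obtain ⟨h₁, hh₁, hb₁⟩ := acts_readView (κ := κ)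
  obtain ⟨h₂, hh₂, hb₂⟩ := acts_readLive (κ := κ)
  obtain ⟨h₃, hh₃, hb₃⟩ := acts_applyRules rules
  refine ⟨_, hh₁.add (hh₂.add hh₃), fun w n x y L r hx => ?_⟩
  have e₁ := hb₁ w n x y L r hx
  obtain ⟨b, hb, e₂⟩ := hb₂ w n x y L { r with view := view w n fun a => x (some a) } hx
  obtain ⟨L', e₃, hL, hL'⟩ := hb₃ w n x y L
    { r with
      view := view w n fun a => x (some a)
      acc := r.acc || b
      live := b } hx
  refine ⟨_, L', e₁.seq (e₂.seq e₃), rfl, ?_, hL, ?_⟩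
  · simp only [Bool.or_eq_true, hb]
  · simpa only [hb] using hL'

end Machine

section Run

variable {κ : Type} [DecidableEq κ] [Fintype κ]

/-! ### Running all transitions -/

/-- Makes all transitions from the states that are reachable in a given number of transitions. -/
noncomputable def allTransitions (rules : List (Rule κ)) : MachineProg κ :=
  seq (act fun r => { r with acc := false })
    (seq (loops ((Finset.univ.toList : List (Option κ)).map some) (body rules))
      (act fun r => { r with first := false }))

theorem acts_allTransitions (rules : List (Rule κ)) :
    ∃ h, PolyBounded h ∧ ∀ (w : List Symbol) (n : ℕ) (x y : LoopVar κ → ℕ) (L : List Symbol)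
      (r : Ctrl κ), (∀ a, x (some a) = 0) → (∀ a, y (some a) = 0) → x none ≤ n →
      L.length ≤ tableBound κ n → ∀ Live : (κ → ℕ) → Prop,
      (∀ s, (∀ k, s k ≤ n) → (Live s ↔ r.first = true ∨
        L.getD (keyCode n (slots κ) (x none) s) blank = mark)) → ∃ r' L',
      Acts (allTransitions rules) (store w n x y L 0) (store w n x y L' 0) r r' (h n) ∧
      r'.first = false ∧ (r'.acc = true ↔ ∃ s : κ → ℕ, (∀ k, s k ≤ n) ∧ Live s) ∧
      L'.length ≤ tableBound κ n ∧
      ∀ p (s : κ → ℕ), (∀ k, s k ≤ n) → (L'.getD (keyCode n (slots κ) p s) blank = mark ↔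
        L.getD (keyCode n (slots κ) p s) blank = mark ∨ (p = x none + 1 ∧
          ∃ e : Option κ → ℕ, (∀ a, e a ≤ n) ∧ Live (fun k => e (some k)) ∧
            ∃ rule ∈ rules, rule.cond (view w n e) = true ∧ s = fun k => e (rule.dst k))) := by
  obtain ⟨h, hh, hb⟩ := acts_body rules
  refine ⟨_, (PolyBounded.const 1).add ((polyBounded_forTime_iterate hh
    ((Finset.univ.toList : List (Option κ)).map some).length).add (.const 1)),
    fun w n x y L r hx hy hxn hL Live hLive => ?_⟩
  have hnodup : ((Finset.univ.toList : List (Option κ)).map (some : _ → LoopVar κ)).Nodup :=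
    (Finset.nodup_toList _).map (Option.some_injective _)
  have hmem : ∀ z : LoopVar κ → ℕ, z ∈ tuples n ((Finset.univ.toList : List (Option κ)).map
      (some : _ → LoopVar κ)) x ↔ (∀ a, z (some a) ≤ n) ∧ z none = x none := by
    intro z
    rw [mem_tuples hnodup]
    constructor
    · rintro ⟨h₁, h₂⟩
      exact ⟨fun a => h₁ _ (by simp), h₂ _ (by simp)⟩
    · rintro ⟨h₁, h₂⟩
      refine ⟨fun a ha => ?_, fun a ha => ?_⟩
      · obtain ⟨b, -, rfl⟩ := List.mem_map.mp ha
        exact h₁ b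
      · rcases a with _ | a
        · exact h₂
        · simp at ha
  obtain ⟨r', L', h₁, -, h₂, h₃, h₄, h₅⟩ := acts_loops (w := w) (n := n) (B := h n)
    (body := body rules) ((Finset.univ.toList : List (Option κ)).map some) hnodup
    (fun l r' L' => (∀ z ∈ l, ∀ a, z (some a) ≤ n) ∧ r'.first = r.first ∧
      (r'.acc = true ↔ ∃ z ∈ l, Live fun k => z (some (some k))) ∧
      L'.length ≤ tableBound κ n ∧
      ∀ i, L'.getD i blank = mark ↔ L.getD i blank = mark ∨ ∃ z ∈ l,
        Live (fun k => z (some (some k))) ∧ ∃ rule ∈ rules,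
          rule.cond (view w n fun a => z (some a)) = true ∧
          i = keyCode n (slots κ) (x none + 1) fun k => z (some (rule.dst k)))
    (x₀ := x)
    (fun a ha => by
      obtain ⟨b, -, rfl⟩ := List.mem_map.mp ha
      exact hx b)
    (fun z hz y l r₁ L₁ hJ => by
      obtain ⟨hl, hJ₁, hJ₂, hJ₃, hJ₄⟩ := hJ
      obtain ⟨hz₁, hz₂⟩ := (hmem z).mp hz
      have hzn : ∀ a, z a ≤ n := by
        rintro (_ | a)
        · omega
        · exact hz₁ a
      obtain ⟨r₂, L₂, e₁, e₂, e₃, e₄, e₅⟩ := hb w n z y L₁ r₁ hzn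
      -- The transitions made so far have only changed entries for a larger number of transitions.
      have hlive : (r₁.first = true ∨
          L₁.getD (keyCode n (slots κ) (z none) fun k => z (some (some k))) blank = mark) ↔
          Live fun k => z (some (some k)) := by
        rw [hLive _ (fun k => hz₁ _), hJ₁, hJ₄, hz₂, or_iff_left (a := L.getD _ _ = _)]
        rintro ⟨z', hz', -, rule, -, -, hcode⟩
        have := (keyCode_inj (fun k => hz₁ _) (fun k => hl z' hz' _) _ hcode).1
        omega
      rw [hlive] at e₃ e₅
      refine ⟨r₂, L₂, e₁, fun z' hz' => ?_, e₂.trans hJ₁, ?_,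
        e₄.trans (max_le hJ₃ le_rfl), fun i => ?_⟩
      · rcases List.mem_append.mp hz' with hz' | hz'
        · exact hl z' hz'
        · rw [List.mem_singleton.mp hz']
          exact hz₁
      · rw [e₃, hJ₂]
        simp only [List.mem_append, List.mem_singleton, or_and_right, exists_or, exists_eq_left]
      · rw [e₅, hJ₄, hz₂, or_assoc]
        simp only [List.mem_append, List.mem_singleton, or_and_right, exists_or, exists_eq_left])
    y [] { r with acc := false } L
    (fun a ha => by
      obtain ⟨b, -, rfl⟩ := List.mem_map.mp ha
      exact hy b)
    ⟨by simp, rfl, by simp, hL, by simp⟩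
  refine ⟨_, L', (acts_act _ _ _).seq (h₁.seq (acts_act _ _ _)), rfl, ?_, h₄, ?_⟩
  · rw [h₃]
    constructor
    · rintro ⟨z, hz, hlive⟩
      exact ⟨_, fun k => ((hmem z).mp hz).1 _, hlive⟩
    · rintro ⟨s, hs, hlive⟩
      refine ⟨fun a => a.elim (x none) fun a => a.elim 0 s, ?_, hlive⟩
      refine (hmem _).mpr ⟨?_, rfl⟩
      rintro (_ | k)
      · exact Nat.zero_le n
      · exact hs k
  · intro p s hs
    rw [h₅]
    refine or_congr Iff.rfl ⟨?_, ?_⟩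
    · rintro ⟨z, hz, hlive, rule, hrule, hcond, hcode⟩
      have hz₁ := ((hmem z).mp hz).1
      obtain ⟨hp, hs'⟩ := keyCode_inj hs (fun k => hz₁ _) _ hcode
      exact ⟨hp, fun a => z (some a), hz₁, hlive, rule, hrule, hcond,
        funext fun k => hs' k (Finset.mem_toList.mpr (Finset.mem_univ k))⟩
    · rintro ⟨rfl, e, he, hlive, rule, hrule, hcond, rfl⟩
      exact ⟨fun a => a.elim (x none) e, (hmem _).mpr ⟨he, rfl⟩, hlive, rule, hrule, hcond, rfl⟩

end Run
end StackProg

/-- Polynomials with natural coefficients are monotone functions. -/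
theorem Polynomial.eval_mono_nat (P : Polynomial ℕ) : Monotone fun n => P.eval n := by
  intro m n hmn
  simp only [Polynomial.eval_eq_sum, Polynomial.sum]
  exact Finset.sum_le_sum fun i _ => Nat.mul_le_mul_left _ (Nat.pow_le_pow_left hmn i)

namespace StackProg

open ListThreeInstance (Symbol)

/-! ### Initialization and cleaning up -/

section Main

variable {V ρ : Type} [DecidableEq V]

/-- Puts the number of blocks of the input word, plus one, on the stack `base` in unary. -/
def init : StackProg (Reg V) Symbol (Option Symbol × ρ) :=
  seq (drain .inp (seq (ite (fun s => s.1.elim false Sum.isLeft) (push .base fun _ => mark) skip)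
    (pushBuf mark .aux))) (seq (pour mark .aux .inp) (push .base fun _ => mark))

theorem acts_init (w : List Symbol) (r : ρ) :
    Acts (init : StackProg (Reg V) Symbol (Option Symbol × ρ))
      (Function.update (fun _ => []) .inp w)
      (store w (w.countP Sum.isLeft) (fun _ => 0) (fun _ => 0) [] 0) r r
      (w.length * 8 + 5) := fun o => by
  obtain ⟨r', S', h, rfl, hinp, haux, hbase, hS⟩ := runs_drain (A := Reg.inp)
    (body := seq (ite (fun s => s.1.elim false Sum.isLeft) (push .base fun _ => mark) skip)
      (pushBuf mark .aux)) (B := 1 + 1 + 1)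
    (fun l r' (T : Reg V → List Symbol) => r' = r ∧ T .inp = l ∧
      l.reverse ++ T .aux = w.reverse ∧
      List.replicate (l.countP Sum.isLeft) mark ++ T .base =
        List.replicate (w.countP Sum.isLeft) mark ∧
      ∀ k, k ≠ .inp → k ≠ .aux → k ≠ .base → T k = [])
    (fun l r T h => h.2.1)
    (fun g l r' T h => by
      obtain ⟨rfl, hinp, haux, hbase, hT⟩ := h
      have hite : Runs (ite (fun s : Option Symbol × ρ => s.1.elim false Sum.isLeft)
          (push .base fun _ => mark) skip) ((some g, r'), Function.update T .inp l)
          ((some g, r'), Function.update (Function.update T .inp l) .base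
            (List.replicate (if g.isLeft = true then 1 else 0) mark ++ T .base)) (1 + 1) := by
        refine runs_ite ?_
        by_cases hg : g.isLeft = true
        · simp only [Option.elim_some, hg, if_true]
          exact (runs_push _ _ _ _).congr (by simp)
        · simp only [Option.elim_some, hg]
          refine (runs_skip _).congr (Prod.ext rfl (Function.update_eq_self_iff.mpr ?_).symm)
          simp
      refine ⟨_, _, _, hite.seq (runs_push _ _ _ _), rfl, by simp, by simpa using haux, ?_,
        fun k h₁ h₂ h₃ => by simp [h₁, h₂, h₃, hT]⟩
      rw [List.countP_cons, ← List.replicate_append_replicate, List.append_assoc] at hbase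
      simpa using hbase)
    w r (Function.update (fun _ => []) .inp w) o
    ⟨rfl, by simp, by simp, by simp, fun k h₁ _ _ => by simp [h₁]⟩
  simp only [List.reverse_nil, List.nil_append, List.countP_nil, List.replicate_zero] at haux hbase
  have h₂ := runs_pour (d := mark) (A := Reg.aux) (B := .inp) (by simp) (none, r') S'
  rw [haux, hinp, List.length_reverse, List.reverse_reverse, List.append_nil] at h₂
  refine ⟨none, Runs.mono (h.seq (h₂.seq ((runs_push _ _ _ _).congr (Prod.ext rfl
    (funext fun k => ?_))))) (by omega)⟩
  cases k <;> simp [store, hbase, hS, List.replicate_succ]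

/-- Empties the stacks in the list. -/
def clear (ks : List (Reg V)) : StackProg (Reg V) Symbol (Option Symbol × ρ) :=
  seqs (ks.map fun k => drain k skip)

theorem acts_clear (ks : List (Reg V)) (S : Reg V → List Symbol) (r : ρ) (M : ℕ)
    (hM : ∀ k, (S k).length ≤ M) :
    Acts (clear ks) S (fun k => if k ∈ ks then [] else S k) r r
      (ks.length * (M * 3 + 2) + 1) := by
  induction ks generalizing S with
  | nil => simpa [clear, seqs] using acts_skip S r
  | cons k ks ih =>
    have h₁ : Acts (drain k skip) S (Function.update S k []) r r (M * 3 + 2) := fun o =>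
      ⟨none, (runs_drain_skip k (o, r) S).mono (by have := hM k; omega)⟩
    have h₂ := ih (Function.update S k []) fun k' => by
      by_cases hk : k' = k
      · subst hk
        simp
      · simpa [hk] using hM k'
    have h₃ : (fun k' => if k' ∈ ks then [] else Function.update S k [] k') =
        fun k' => if k' ∈ k :: ks then [] else S k' := by
      funext k'
      by_cases hk : k' = k
      · subst hk
        simp
      · simp [hk]
    rw [h₃] at h₂
    refine (h₁.seq h₂).mono ?_
    rw [List.length_cons, Nat.add_mul]
    omega

end Main

/-! ### The decision procedure for a transition system -/

section Decision

variable {κ : Type} [DecidableEq κ] [Fintype κ]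

/-- The machine that decides whether there is a run of `n` transitions, where `n` is the number of
blocks of the input word. -/
noncomputable def decider (rules : List (Rule κ)) : MachineProg κ :=
  have : Fintype (Reg (LoopVar κ)) := @Fintype.ofFinite _ (finite_reg _)
  seq init (seq (forLoop none (allTransitions rules)) (clear Finset.univ.toList))

theorem acts_decider (rules : List (Rule κ)) :
    ∃ time : Polynomial ℕ, ∀ (w : List Symbol) (r : Ctrl κ), r.first = true → ∃ r',
      Acts (decider rules) (Function.update (fun _ => []) .inp w) (fun _ => []) r r'
        (time.eval w.length) ∧
      (r'.acc = true ↔ ∃ s : κ → ℕ, (∀ k, s k ≤ w.countP Sum.isLeft) ∧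
        Reach w (w.countP Sum.isLeft) rules (w.countP Sum.isLeft) s) := by
  let _ : Fintype (Reg (LoopVar κ)) := @Fintype.ofFinite _ (finite_reg _)
  obtain ⟨h, hh, hb⟩ := acts_allTransitions rules
  have hn : PolyBounded fun n => n + 1 := PolyBounded.id.add (.const 1)
  obtain ⟨P, hP⟩ := polyBounded_forTime_iterate hh 1
  obtain ⟨Q, hQ⟩ : PolyBounded fun n => n + 1 + tableBound κ n :=
    hn.add ((PolyBounded.id.add (.const 2)).mul (hn.pow _))
  refine ⟨(Polynomial.X * 8 + 5) + (P + (Polynomial.C (Fintype.card (Reg (LoopVar κ))) *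
    ((Polynomial.X + Q) * 3 + 2) + 1)), fun w r hr => ?_⟩
  set n := w.countP Sum.isLeft with hn_def
  have hnw : n ≤ w.length := List.countP_le_length
  obtain ⟨r', L', h₁, -, hL', hacc, -⟩ := acts_forLoop (w := w) (n := n) (x := fun _ => 0)
    (y := fun _ => 0) (L := []) (r := r) (B := h n) (a := none) (body := allTransitions rules)
    rfl rfl
    (fun t r L => (r.first = true ↔ t = 0) ∧ L.length ≤ tableBound κ n ∧
      (∀ p, t = p + 1 → (r.acc = true ↔ ∃ s : κ → ℕ, (∀ k, s k ≤ n) ∧ Reach w n rules p s)) ∧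
      ∀ p (s : κ → ℕ), (∀ k, s k ≤ n) →
        (L.getD (keyCode n (slots κ) (p + 1) s) blank = mark ↔ p + 1 ≤ t ∧
          Reach w n rules (p + 1) s))
    (fun t ht r L hI => by
      obtain ⟨hI₁, hI₂, -, hI₄⟩ := hI
      have hlive : ∀ s : κ → ℕ, (∀ k, s k ≤ n) → (Reach w n rules t s ↔ r.first = true ∨
          L.getD (keyCode n (slots κ) (Function.update (fun _ : LoopVar κ => 0) none t none) s)
            blank = mark) := by
        intro s hs
        rw [Function.update_self, hI₁]
        rcases t with _ | t
        · simp [Reach]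
        · rw [hI₄ t s hs]
          simp
      obtain ⟨r', L', e₁, e₂, e₃, e₄, e₅⟩ := hb w n (Function.update (fun _ => 0) none t)
        (Function.update (fun _ => 0) none (n - t)) L r (by simp) (by simp) (by simpa using ht)
        hI₂ (Reach w n rules t) hlive
      refine ⟨r', L', e₁, by simp [e₂], e₄, ?_, fun p s hs => ?_⟩
      · rintro p hp
        obtain rfl : t = p := by omega
        exact e₃
      · rw [e₅ _ s hs, hI₄ p s hs, Function.update_self]
        constructor
        · rintro (⟨hp, hR⟩ | ⟨hp, hR⟩)
          · exact ⟨by omega, hR⟩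
          · obtain rfl : p = t := by omega
            exact ⟨le_rfl, hR⟩
        · rintro ⟨hp, hR⟩
          rcases Nat.lt_or_ge p t with hpt | hpt
          · exact Or.inl ⟨hpt, hR⟩
          · obtain rfl : p = t := by omega
            exact Or.inr ⟨rfl, hR⟩)
    ⟨by simp [hr], by simp, by simp, fun p s _ => by simp [blank, mark]⟩
  refine ⟨r', ?_, hacc n rfl⟩
  have h₂ := acts_clear (Finset.univ.toList : List (Reg (LoopVar κ)))
    (store w n (fun _ => 0) (fun _ => 0) L' 0) r' (w.length + (n + 1 + tableBound κ n))
    (fun k => by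
      cases k <;> simp only [store, List.length_replicate, List.length_nil] <;> omega)
  simp only [Finset.mem_toList, Finset.mem_univ, if_true, Finset.length_toList] at h₂
  refine Acts.mono ((acts_init w r).seq (h₁.seq h₂)) ?_
  have hP' := (hP n).trans (P.eval_mono_nat hnw)
  have hQ' := (hQ n).trans (Q.eval_mono_nat hnw)
  simp only [Function.iterate_one] at hP'
  simp only [Polynomial.eval_add, Polynomial.eval_mul, Polynomial.eval_X, Polynomial.eval_C,
    Polynomial.eval_ofNat, Polynomial.eval_one, Finset.card_univ]
  gcongr

/-- Whether a transition system on a constant number of indices has a run whose length is the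
number of blocks of the input word can be decided in polynomial time. -/
theorem solvableInPolyTime_of_reach {α : Type} {encode : α → List Symbol} {P : α → Prop}
    (rules : List (Rule κ))
    (hP : ∀ a, P a ↔ ∃ s : κ → ℕ, (∀ k, s k ≤ (encode a).countP Sum.isLeft) ∧
      Reach (encode a) ((encode a).countP Sum.isLeft) rules ((encode a).countP Sum.isLeft) s) :
    SolvableInPolyTime encode P := by
  let _ : Fintype (Reg (LoopVar κ)) := @Fintype.ofFinite _ (finite_reg _)
  let _ : Fintype (Ctrl κ) := @Fintype.ofFinite _ (finite_ctrl _)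
  obtain ⟨time, h⟩ := acts_decider rules
  refine solvableInPolyTime (decider rules) .inp
    (none, ⟨(fun _ _ => none, fun _ => none), true, false, false⟩) (fun s => s.2.acc) time
    fun a => ?_
  obtain ⟨r', h₁, h₂⟩ := h (encode a) ⟨(fun _ _ => none, fun _ => none), true, false, false⟩ rfl
  obtain ⟨o', t, ht, h₃⟩ := h₁ none
  exact ⟨t, ht, (o', r'), h₃, h₂.trans (hP a).symm⟩

end Decision

end StackProg

/-! ### Copies of an ordered graph with at most one edge -/

namespace OrderedGraph

theorem isInducedSubgraph_of_embedding {W V : Type*} {H : OrderedGraph W} {G : OrderedGraph V}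
    (f : W → V) (hord : ∀ w w', H.ord w < H.ord w' → G.ord (f w) < G.ord (f w'))
    (hadj : ∀ w w', H.graph.Adj w w' ↔ G.graph.Adj (f w) (f w')) : H.IsInducedSubgraph G := by
  have hf : Function.Injective f := by
    intro w w' h
    by_contra hne
    rcases lt_or_gt_of_ne (H.ord_injective.ne hne) with hlt | hlt
    · exact (hord _ _ hlt).ne (by rw [h])
    · exact (hord _ _ hlt).ne (by rw [h])
  refine ⟨Set.range f, Equiv.ofInjective f hf, fun w w' => ⟨⟨hord w w', fun h => ?_⟩, hadj w w'⟩⟩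
  by_contra hle
  rcases (not_lt.mp hle).lt_or_eq with hlt | heq
  · exact lt_asymm h (hord _ _ hlt)
  · rw [H.ord_injective heq] at h
    exact lt_irrefl _ h

/-- An edge `uv` together with long enough independent sequences before `u`, between `u` and `v`,
and after `v` contains every ordered graph with at most one edge. -/
theorem isInducedSubgraph_of_edge {W V : Type*} [Finite W] {H : OrderedGraph W}
    {G : OrderedGraph V} (hH : H.graph.edgeSet.encard ≤ 1) {u v : V} (huv : G.graph.Adj u v)
    {pre mid post : Fin (Nat.card W) → V} (T : Set V) (hpreT : ∀ j, pre j ∈ T)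
    (hmidT : ∀ j, mid j ∈ T) (hpostT : ∀ j, post j ∈ T)
    (hT : ∀ z ∈ T, ∀ z' ∈ T, ¬ G.graph.Adj z z') (huT : ∀ z ∈ T, ¬ G.graph.Adj u z)
    (hvT : ∀ z ∈ T, ¬ G.graph.Adj v z)
    (hpre : ∀ i j, i < j → G.ord (pre i) < G.ord (pre j))
    (hmid : ∀ i j, i < j → G.ord (mid i) < G.ord (mid j))
    (hpost : ∀ i j, i < j → G.ord (post i) < G.ord (post j))
    (hpu : ∀ j, G.ord (pre j) < G.ord u) (hum : ∀ j, G.ord u < G.ord (mid j))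
    (hmv : ∀ j, G.ord (mid j) < G.ord v) (hvp : ∀ j, G.ord v < G.ord (post j)) :
    H.IsInducedSubgraph G := by
  classical
  have := Fintype.ofFinite W
  obtain ⟨r, hr⟩ : ∃ r : W → Fin (Nat.card W), ∀ w w', H.ord w < H.ord w' → r w < r w' := by
    let _ : LinearOrder W := LinearOrder.lift' H.ord H.ord_injective
    exact ⟨(Fintype.orderIsoFinOfCardEq W Nat.card_eq_fintype_card.symm).symm,
      fun w w' h => (OrderIso.lt_iff_lt _).mpr h⟩
  by_cases hE : ∃ a b, H.graph.Adj a b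
  · obtain ⟨a, b, hab, hlt⟩ : ∃ a b, H.graph.Adj a b ∧ H.ord a < H.ord b := by
      obtain ⟨a, b, hab⟩ := hE
      rcases lt_or_gt_of_ne (H.ord_injective.ne hab.ne) with h | h
      · exact ⟨a, b, hab, h⟩
      · exact ⟨b, a, hab.symm, h⟩
    have huniq : ∀ w w', H.graph.Adj w w' → (w = a ∧ w' = b) ∨ (w = b ∧ w' = a) := by
      intro w w' h
      have := Set.encard_le_one_iff.mp hH s(w, w') s(a, b) h hab
      simpa using this
    obtain ⟨f, hf⟩ : ∃ f : W → V, ∀ w, (H.ord w < H.ord a ∧ f w = pre (r w)) ∨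
        (w = a ∧ f w = u) ∨ (H.ord a < H.ord w ∧ H.ord w < H.ord b ∧ f w = mid (r w)) ∨
        (w = b ∧ f w = v) ∨ (H.ord b < H.ord w ∧ f w = post (r w)) := by
      refine ⟨fun w => if H.ord w < H.ord a then pre (r w) else if w = a then u else
        if H.ord w < H.ord b then mid (r w) else if w = b then v else post (r w), fun w => ?_⟩
      by_cases h₁ : H.ord w < H.ord a
      · exact Or.inl ⟨h₁, if_pos h₁⟩
      by_cases h₂ : w = a
      · exact Or.inr (Or.inl ⟨h₂, by simp [h₂]⟩)
      have h₃ : H.ord a < H.ord w :=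
        lt_of_le_of_ne (not_lt.mp h₁) (H.ord_injective.ne (Ne.symm h₂))
      by_cases h₄ : H.ord w < H.ord b
      · exact Or.inr (Or.inr (Or.inl ⟨h₃, h₄, by simp [h₁, h₂, h₄]⟩))
      by_cases h₅ : w = b
      · exact Or.inr (Or.inr (Or.inr (Or.inl ⟨h₅, by
          simp only [if_neg h₁, if_neg h₂, if_neg h₄, if_pos h₅]⟩)))
      · exact Or.inr (Or.inr (Or.inr (Or.inr ⟨lt_of_le_of_ne (not_lt.mp h₄)
          (H.ord_injective.ne (Ne.symm h₅)), by simp [h₁, h₂, h₄, h₅]⟩)))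
    have hfT : ∀ w, f w ∈ T ∧ w ≠ a ∧ w ≠ b ∨ w = a ∧ f w = u ∨ w = b ∧ f w = v := by
      intro w
      rcases hf w with ⟨h, e⟩ | h | ⟨h, h', e⟩ | h | ⟨h, e⟩
      · refine Or.inl ⟨e ▸ hpreT _, ?_, ?_⟩ <;> rintro rfl <;> linarith
      · exact Or.inr (Or.inl h)
      · refine Or.inl ⟨e ▸ hmidT _, ?_, ?_⟩ <;> rintro rfl <;> linarith
      · exact Or.inr (Or.inr h)
      · refine Or.inl ⟨e ▸ hpostT _, ?_, ?_⟩ <;> rintro rfl <;> linarith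
    refine isInducedSubgraph_of_embedding f (fun w w' hww => ?_) (fun w w' => ⟨fun h => ?_,
      fun h => ?_⟩)
    · have hr' := hr w w' hww
      have h₁ := hpre _ _ hr'
      have h₂ := hmid _ _ hr'
      have h₃ := hpost _ _ hr'
      have h₄ := hpu (r w)
      have h₅ := hum (r w')
      have h₆ := hmv (r w)
      have h₇ := hvp (r w')
      have h₈ := hum (r w)
      have h₉ := hmv (r w')
      rcases hf w with ⟨h, e⟩ | ⟨h, e⟩ | ⟨h, h', e⟩ | ⟨h, e⟩ | ⟨h, e⟩ <;>
      rcases hf w' with ⟨g, e'⟩ | ⟨g, e'⟩ | ⟨g, g', e'⟩ | ⟨g, e'⟩ | ⟨g, e'⟩ <;>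
      rw [e, e'] <;> first
        | linarith
        | (subst h; linarith)
        | (subst g; linarith)
        | (subst h; subst g; linarith)
    · rcases huniq w w' h with ⟨rfl, rfl⟩ | ⟨rfl, rfl⟩
      · rcases hfT w with ⟨-, h₁, -⟩ | ⟨-, h₁⟩ | ⟨h₁, -⟩
        · exact absurd rfl h₁
        · rcases hfT w' with ⟨-, -, h₂⟩ | ⟨h₂, -⟩ | ⟨-, h₂⟩
          · exact absurd rfl h₂
          · exact absurd h₂ h.ne'
          · rwa [h₁, h₂]
        · exact absurd h₁ h.ne
      · rcases hfT w' with ⟨-, h₁, -⟩ | ⟨-, h₁⟩ | ⟨h₁, -⟩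
        · exact absurd rfl h₁
        · rcases hfT w with ⟨-, -, h₂⟩ | ⟨h₂, -⟩ | ⟨-, h₂⟩
          · exact absurd rfl h₂
          · exact absurd h₂ h.ne
          · rw [h₁, h₂]
            exact huv.symm
        · exact absurd h₁ h.ne'
    · rcases hfT w with ⟨h₁, -⟩ | ⟨rfl, h₁⟩ | ⟨rfl, h₁⟩ <;>
      rcases hfT w' with ⟨h₂, -⟩ | ⟨rfl, h₂⟩ | ⟨rfl, h₂⟩
      · exact absurd h (hT _ h₁ _ h₂)
      · exact absurd (h₂ ▸ h.symm) (huT _ h₁)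
      · exact absurd (h₂ ▸ h.symm) (hvT _ h₁)
      · exact absurd (h₁ ▸ h) (huT _ h₂)
      · exact absurd h (G.graph.loopless.irrefl _)
      · exact hab
      · exact absurd (h₁ ▸ h) (hvT _ h₂)
      · exact hab.symm
      · exact absurd h (G.graph.loopless.irrefl _)
  · refine isInducedSubgraph_of_embedding (fun w => pre (r w))
      (fun w w' hww => hpre _ _ (hr _ _ hww))
      (fun w w' => ⟨fun h => absurd ⟨w, w', h⟩ hE, fun h => absurd h (hT _ (hpreT _) _ (hpreT _))⟩)

end OrderedGraph

/-! ### Reading the graph from the input word -/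

theorem List.getElem?_flatMap_of_length {α β : Type*} {f : α → List β} {B : ℕ}
    (hB : ∀ a, (f a).length = B) (l : List α) (i : ℕ) {j : ℕ} (hj : j < B) :
    (l.flatMap f)[i * B + j]? = l[i]?.bind fun a => (f a)[j]? := by
  induction l generalizing i with
  | nil => simp
  | cons a l ih =>
    rw [List.flatMap_cons]
    rcases i with _ | i
    · rw [List.getElem?_append_left (by rw [hB]; omega)]
      simp
    · rw [List.getElem?_append_right (by rw [hB, Nat.add_mul]; omega), hB,
        show (i + 1) * B + j - B = i * B + j by rw [Nat.add_mul]; omega, ih]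
      simp

namespace ListThreeInstance

open Classical in
theorem countP_encode (I : ListThreeInstance) : I.encode.countP Sum.isLeft = I.n := by
  have h : ∀ l : List (Fin I.n), (l.flatMap fun i => (Sum.inl (I.L i) :: (List.finRange I.n).map
      fun j => Sum.inr (decide (I.G.graph.Adj i j), decide (I.G.ord i < I.G.ord j)) :
        List Symbol)).countP Sum.isLeft = l.length := by
    intro l
    induction l with
    | nil => rfl
    | cons a l ih =>
      rw [List.flatMap_cons, List.countP_append, ih, List.countP_cons, List.countP_map]
      simp [Function.comp_def, Nat.add_comm]
  rw [encode, h, List.length_finRange]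

theorem encode_head (I : ListThreeInstance) (i : ℕ) :
    I.encode[i * (I.n + 1)]? = (List.finRange I.n)[i]?.map fun u => Sum.inl (I.L u) := by
  classical
  have h := List.getElem?_flatMap_of_length (f := fun i => (Sum.inl (I.L i) ::
    (List.finRange I.n).map fun j =>
      Sum.inr (decide (I.G.graph.Adj i j), decide (I.G.ord i < I.G.ord j)) : List Symbol))
    (B := I.n + 1) (by simp) (List.finRange I.n) i (Nat.succ_pos I.n)
  rw [encode]
  rw [Nat.add_zero] at h
  refine h.trans ?_
  rcases (List.finRange I.n)[i]? <;> rfl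

open Classical in
theorem encode_pair (I : ListThreeInstance) (i j : ℕ) (hj : j < I.n) :
    I.encode[i * (I.n + 1) + j + 1]? = (List.finRange I.n)[i]?.map fun u =>
      Sum.inr (decide (I.G.graph.Adj u ⟨j, hj⟩), decide (I.G.ord u < I.G.ord ⟨j, hj⟩)) := by
  have h := List.getElem?_flatMap_of_length (f := fun i => (Sum.inl (I.L i) ::
    (List.finRange I.n).map fun j =>
      Sum.inr (decide (I.G.graph.Adj i j), decide (I.G.ord i < I.G.ord j)) : List Symbol))
    (B := I.n + 1) (by simp) (List.finRange I.n) i (Nat.succ_lt_succ hj)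
  rw [encode]
  refine h.trans ?_
  rcases (List.finRange I.n)[i]? with _ | u
  · rfl
  · simp [hj]

end ListThreeInstance

open ListThreeInstance (Symbol)
open StackProg (View view Rule Reach)

/-! ### The transition system for list-3-colorings -/

namespace StackProg.View

variable {κ : Type}

/-- The vertices in the slots `a` and `b` are adjacent. -/
def Adj (v : View κ) (a b : Option κ) : Prop := ∃ q, v.1 a b = some (Sum.inr (true, q))

/-- The vertex in the slot `a` precedes that in the slot `b`. -/
def Lt (v : View κ) (a b : Option κ) : Prop := ∃ q, v.1 a b = some (Sum.inr (q, true))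

/-- The slots `a` and `b` hold the same vertex: neither precedes the other. -/
def Same (v : View κ) (a b : Option κ) : Prop :=
  (∃ q, v.1 a b = some (Sum.inr (q, false))) ∧ ∃ q, v.1 b a = some (Sum.inr (q, false))

/-- The color `c` belongs to the list of the vertex in the slot `a`. -/
def MemList (v : View κ) (c : Fin 3) (a : Option κ) : Prop :=
  ∃ S : Finset (Fin 3), v.2 a = some (Sum.inl S) ∧ c ∈ S

/-- The slot `a` holds a vertex. -/
def Occupied (v : View κ) (a : Option κ) : Prop := ∃ S, v.2 a = some (Sum.inl S)

end StackProg.View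

namespace ListThreeInstance

variable {κ : Type} (I : ListThreeInstance) {e : Option κ → ℕ}

theorem getElem?_finRange_eq_some {n i : ℕ} {u : Fin n} :
    (List.finRange n)[i]? = some u ↔ (u : ℕ) = i := by
  rw [List.getElem?_eq_some_iff]
  constructor
  · rintro ⟨h, rfl⟩
    simp
  · rintro rfl
    simp

open Classical in
theorem view_pair (he : ∀ a, e a ≤ I.n) (a b : Option κ) (p q : Bool) :
    (view I.encode I.n e).1 a b = some (Sum.inr (p, q)) ↔ ∃ u v : Fin I.n, (u : ℕ) = e a ∧
      (v : ℕ) = e b ∧ (p = true ↔ I.G.graph.Adj u v) ∧ (q = true ↔ I.G.ord u < I.G.ord v) := by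
  simp only [view]
  rcases (he b).lt_or_eq with hb | hb
  · rw [encode_pair I _ _ hb, Option.map_eq_some_iff]
    constructor
    · rintro ⟨u, hu, h⟩
      simp only [Sum.inr.injEq, Prod.mk.injEq] at h
      exact ⟨u, ⟨e b, hb⟩, getElem?_finRange_eq_some.mp hu, rfl, by simp [← h.1], by simp [← h.2]⟩
    · rintro ⟨u, v, hu, hv, hp, hq⟩
      obtain rfl : v = ⟨e b, hb⟩ := Fin.ext hv
      refine ⟨u, getElem?_finRange_eq_some.mpr hu, ?_⟩
      simp only [Sum.inr.injEq, Prod.mk.injEq]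
      constructor
      · rw [Bool.eq_iff_iff, hp, decide_eq_true_iff]
      · rw [Bool.eq_iff_iff, hq, decide_eq_true_iff]
  · -- An empty slot: the symbol read is the list of the next vertex, or nothing.
    have h := encode_head I (e a + 1)
    rw [show (e a + 1) * (I.n + 1) = e a * (I.n + 1) + e b + 1 by rw [hb]; ring] at h
    rw [h]
    constructor
    · intro h
      rw [Option.map_eq_some_iff] at h
      obtain ⟨u, -, h⟩ := h
      simp at h
    · rintro ⟨u, v, -, hv, -⟩
      exact absurd (hv.trans hb) v.2.ne

theorem view_head (a : Option κ) (S : Finset (Fin 3)) :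
    (view I.encode I.n e).2 a = some (Sum.inl S) ↔ ∃ u : Fin I.n, (u : ℕ) = e a ∧ I.L u = S := by
  simp only [view]
  rw [encode_head, Option.map_eq_some_iff]
  simp [getElem?_finRange_eq_some]

theorem view_adj (he : ∀ a, e a ≤ I.n) {a b : Option κ} :
    (view I.encode I.n e).Adj a b ↔ ∃ u v : Fin I.n, (u : ℕ) = e a ∧ (v : ℕ) = e b ∧
      I.G.graph.Adj u v := by
  classical
  simp only [View.Adj, view_pair I he, true_iff]
  constructor
  · rintro ⟨q, u, v, hu, hv, h, -⟩
    exact ⟨u, v, hu, hv, h⟩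
  · rintro ⟨u, v, hu, hv, h⟩
    exact ⟨decide (I.G.ord u < I.G.ord v), u, v, hu, hv, h, by simp⟩

theorem view_lt (he : ∀ a, e a ≤ I.n) {a b : Option κ} :
    (view I.encode I.n e).Lt a b ↔ ∃ u v : Fin I.n, (u : ℕ) = e a ∧ (v : ℕ) = e b ∧
      I.G.ord u < I.G.ord v := by
  classical
  simp only [View.Lt, view_pair I he, true_iff]
  constructor
  · rintro ⟨q, u, v, hu, hv, -, h⟩
    exact ⟨u, v, hu, hv, h⟩
  · rintro ⟨u, v, hu, hv, h⟩
    exact ⟨decide (I.G.graph.Adj u v), u, v, hu, hv, by simp, h⟩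

theorem view_same (he : ∀ a, e a ≤ I.n) {a b : Option κ} :
    (view I.encode I.n e).Same a b ↔ ∃ u : Fin I.n, (u : ℕ) = e a ∧ (u : ℕ) = e b := by
  classical
  simp only [View.Same, view_pair I he, Bool.false_eq_true, false_iff]
  constructor
  · rintro ⟨⟨-, u, v, hu, hv, -, h⟩, -, v', u', hv', hu', -, h'⟩
    obtain rfl : u = u' := Fin.ext (hu.trans hu'.symm)
    obtain rfl : v = v' := Fin.ext (hv.trans hv'.symm)
    obtain rfl : u = v := I.G.ord_injective (le_antisymm (not_lt.mp h') (not_lt.mp h))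
    exact ⟨u, hu, hv⟩
  · rintro ⟨u, hu, hv⟩
    exact ⟨⟨false, u, u, hu, hv, by simp, lt_irrefl _⟩, false, u, u, hv, hu, by simp, lt_irrefl _⟩

theorem view_memList {c : Fin 3} {a : Option κ} :
    (view I.encode I.n e).MemList c a ↔ ∃ u : Fin I.n, (u : ℕ) = e a ∧ c ∈ I.L u := by
  simp only [View.MemList, view_head]
  constructor
  · rintro ⟨S, ⟨u, hu, rfl⟩, hc⟩
    exact ⟨u, hu, hc⟩
  · rintro ⟨u, hu, hc⟩
    exact ⟨_, ⟨u, hu, rfl⟩, hc⟩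

theorem view_occupied {a : Option κ} :
    (view I.encode I.n e).Occupied a ↔ ∃ u : Fin I.n, (u : ℕ) = e a := by
  simp [View.Occupied, view_head]

end ListThreeInstance

/-- The slots of the transition system for colorings: the vertex colored last, and for each color
`i` the `k` vertices colored `i` last, latest first, and two sequences that are meant to be the
first `k` vertices of the color class, in order, and the last `k`, in reverse order. -/
inductive Slot (k : ℕ)
  | cur
  | win (i : Fin 3) (j : Fin k)
  | low (i : Fin 3) (j : Fin k)
  | high (i : Fin 3) (j : Fin k)
  deriving DecidableEq, Fintype

namespace Slot

variable {k : ℕ}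

/-- The new vertex lies after the sequence `low c` and before the sequence `high c`, which are
complete, in order, and together independent. -/
def Guarded (c : Fin 3) (v : View (Slot k)) : Prop :=
  (∀ j, v.Lt (some (low c j)) none) ∧ (∀ j, v.Lt none (some (high c j))) ∧
  (∀ j j', j < j' → v.Lt (some (low c j)) (some (low c j'))) ∧
  (∀ j j', j < j' → v.Lt (some (high c j')) (some (high c j))) ∧
  (∀ j j', ¬ v.Adj (some (low c j)) (some (low c j'))) ∧
  (∀ j j', ¬ v.Adj (some (low c j)) (some (high c j'))) ∧
  ∀ j j', ¬ v.Adj (some (high c j)) (some (high c j'))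

/-- The new vertex may be the next vertex in the order and get the color `c`: its adjacency is
tested only against the vertices held by the slots of the color `c`. -/
def Allowed (c : Fin 3) (v : View (Slot k)) : Prop :=
  v.MemList c none ∧ (v.Occupied (some cur) → v.Lt (some cur) none) ∧
  (∀ j, ¬ v.Adj none (some (win c j))) ∧ (∀ j, ¬ v.Adj none (some (low c j))) ∧
  (∀ j, ¬ v.Adj none (some (high c j))) ∧
  ((∃ j, v.Same none (some (low c j))) ∨ (∃ j, v.Same none (some (high c j))) ∨ Guarded c v)

/-- Where the contents of the slots come from when the new vertex gets the color `c`. -/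
def next (c : Fin 3) : Slot k → Option (Slot k)
  | cur => none
  | win i j => if i = c then
      (if h : (j : ℕ) = 0 then none else some (win i ⟨j - 1, by omega⟩)) else some (win i j)
  | low i j => some (low i j)
  | high i j => some (high i j)

open Classical in
/-- The rule that gives the new vertex the color `c`. -/
noncomputable def colorRule (k : ℕ) (c : Fin 3) : Rule (Slot k) where
  cond v := decide (Allowed c v)
  dst := next c

/-- The rules of the transition system for colorings. -/
noncomputable def colorRules (k : ℕ) : List (Rule (Slot k)) :=
  (List.finRange 3).map (colorRule k)

end Slot

namespace ListThreeInstance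

open Slot

/-! ### Runs yield colorings -/

/-- A run of the transition system as a sequence: `E q` holds the contents of the slots before the
transition `q` and, in the slot `none`, the vertex that this transition colors. -/
theorem exists_sequence_of_reach {w : List Symbol} {n k p : ℕ} {s : Slot k → ℕ}
    (h : Reach w n (colorRules k) p s) :
    ∃ (E : ℕ → Option (Slot k) → ℕ) (col : ℕ → Fin 3), (∀ a, E p (some a) = s a) ∧
      ∀ q < p, (∀ a, E q a ≤ n) ∧ Allowed (col q) (view w n (E q)) ∧
        ∀ a, E (q + 1) (some a) = E q (next (col q) a) := by
  induction p generalizing s with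
  | zero => exact ⟨fun _ a => a.elim 0 s, fun _ => 0, fun _ => rfl, by simp⟩
  | succ p ih =>
    obtain ⟨e, he, hR, rule, hrule, hcond, rfl⟩ := h
    obtain ⟨c, -, rfl⟩ := List.mem_map.mp hrule
    obtain ⟨E, col, hEp, hE⟩ := ih hR
    refine ⟨fun q => if q < p then E q else if q = p then e
      else fun a => a.elim 0 fun a => e (next c a), fun q => if q < p then col q else c,
      fun a => by simp [colorRule], fun q hq => ?_⟩
    rcases Nat.lt_succ_iff_lt_or_eq.mp hq with hq | rfl
    · obtain ⟨h₁, h₂, h₃⟩ := hE q hq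
      simp only [if_pos hq]
      refine ⟨h₁, h₂, fun a => ?_⟩
      rw [← h₃ a]
      rcases (Nat.succ_le_of_lt hq).lt_or_eq with hq' | hq'
      · simp [hq']
      · subst hq'
        simp [hEp]
    · simp only [lt_irrefl, if_false, if_true]
      exact ⟨he, by simpa [colorRule] using hcond, fun a => by simp⟩

/-- The windows record the color classes: at the time `b`, the vertices with the color of the
vertex `a` that were colored from `a` on are `t 0, …, t m = a`, latest first, and the window for
this color starts with them. -/
theorem exists_window {n k : ℕ} {E : ℕ → Option (Slot k) → ℕ} {col : ℕ → Fin 3}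
    (hE : ∀ q < n, ∀ a, E (q + 1) (some a) = E q (next (col q) a)) (a : ℕ) :
    ∀ b, a < b → b < n → ∃ (m : ℕ) (t : ℕ → ℕ),
      (∀ j < m, a < t j ∧ t j < b ∧ col (t j) = col a) ∧
      (∀ j j', j < j' → j' < m → t j' < t j) ∧ t m = a ∧
      ∀ j (hj : j < k), j ≤ m → E b (some (win (col a) ⟨j, hj⟩)) = E (t j) none := by
  intro b hab
  induction b, hab using Nat.le_induction with
  | base =>
    intro hb
    refine ⟨0, fun _ => a, by simp, by simp, rfl, fun j hj hjm => ?_⟩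
    obtain rfl : j = 0 := by omega
    rw [hE a (by omega)]
    simp [next]
  | succ b hab ih =>
    intro hb
    obtain ⟨m, t, h₁, h₂, h₃, h₄⟩ := ih (by omega)
    by_cases hc : col a = col b
    · refine ⟨m + 1, fun j => if j = 0 then b else t (j - 1), fun j hj => ?_,
        fun j j' hjj' hj' => ?_, by simpa using h₃, fun j hj hjm => ?_⟩
      · rcases j with _ | j
        · simp [hc]
          omega
        · obtain ⟨g₁, g₂, g₃⟩ := h₁ j (by omega)
          simpa [g₃] using ⟨g₁, by omega⟩
      · obtain ⟨j', rfl⟩ : ∃ i, j' = i + 1 := ⟨j' - 1, by omega⟩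
        rcases j with _ | j
        · simpa using (h₁ j' (by omega)).2.1
        · simpa using h₂ j j' (by omega) (by omega)
      · rw [hE b (by omega)]
        rcases j with _ | j
        · simp [next, hc]
        · simpa [next, hc] using hc ▸ h₄ j (by omega) (by omega)
    · refine ⟨m, t, fun j hj => ?_, h₂, h₃, fun j hj hjm => ?_⟩
      · obtain ⟨g₁, g₂, g₃⟩ := h₁ j hj
        exact ⟨g₁, by omega, g₃⟩
      · rw [hE b (by omega), ← h₄ j hj hjm]
        simp [next, hc]

/-- The colors given along a run with `n` transitions form a proper coloring, if the graph is
`H`-free: a conflict `a, b` with `b` least, the vertices in the slots `low` and `high` of its color,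
and the window of this color at the time `b` would contain a copy of `H`. -/
theorem listColorable_of_sequence {W : Type*} [Finite W] {H : OrderedGraph W}
    (hH : H.graph.edgeSet.encard ≤ 1) (I : ListThreeInstance) (hfree : I.G.Free H)
    {E : ℕ → Option (Slot (Nat.card W)) → ℕ} {col : ℕ → Fin 3}
    (hE : ∀ q < I.n, (∀ a, E q a ≤ I.n) ∧ Allowed (col q) (view I.encode I.n (E q)) ∧
      ∀ a, E (q + 1) (some a) = E q (next (col q) a)) :
    I.G.ListColorable I.L := by
  have hV : ∀ q : ℕ, q < I.n → ∃ u : Fin I.n, (u : ℕ) = E q none ∧ col q ∈ I.L u := fun q hq =>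
    (view_memList I).mp (hE q hq).2.1.1
  choose x hx hxL using hV
  -- The vertices colored by the run increase, so the run colors all vertices.
  have hmono : ∀ a b (ha : a < I.n) (hb : b < I.n), a < b →
      I.G.ord (x a ha) < I.G.ord (x b hb) := by
    intro a b ha hb hab
    induction b, hab using Nat.le_induction with
    | base =>
      have hcur := (hE a ha).2.2 cur
      obtain ⟨u, v, hu, hv, hlt⟩ := (view_lt I (hE (a + 1) hb).1).mp ((hE (a + 1) hb).2.1.2.1
        ((view_occupied I).mpr ⟨x a ha, by rw [hx, hcur]; rfl⟩))
      obtain rfl : u = x a ha := Fin.ext (by rw [hu, hx, hcur]; rfl)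
      obtain rfl : v = x (a + 1) hb := Fin.ext (by rw [hv, hx])
      exact hlt
    | succ b hab ih =>
      have hb' : b < I.n := by omega
      refine (ih hb').trans ?_
      have hcur := (hE b hb').2.2 cur
      obtain ⟨u, v, hu, hv, hlt⟩ := (view_lt I (hE (b + 1) hb).1).mp ((hE (b + 1) hb).2.1.2.1
        ((view_occupied I).mpr ⟨x b hb', by rw [hx, hcur]; rfl⟩))
      obtain rfl : u = x b hb' := Fin.ext (by rw [hu, hx, hcur]; rfl)
      obtain rfl : v = x (b + 1) hb := Fin.ext (by rw [hv, hx])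
      exact hlt
  have hsurj : Function.Surjective fun q : Fin I.n => x q q.2 := by
    refine Finite.surjective_of_injective fun a b hab => ?_
    by_contra hne
    rcases lt_or_gt_of_ne hne with h | h
    · exact (hmono a b a.2 b.2 h).ne (by rw [hab])
    · exact (hmono b a b.2 a.2 h).ne (by rw [hab])
  have hlow : ∀ q < I.n, ∀ i j, E q (some (low i j)) = E 0 (some (low i j)) := by
    intro q hq i j
    induction q with
    | zero => rfl
    | succ q ih => rw [(hE q (by omega)).2.2, ← ih (by omega)]; rfl
  have hhigh : ∀ q < I.n, ∀ i j, E q (some (high i j)) = E 0 (some (high i j)) := by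
    intro q hq i j
    induction q with
    | zero => rfl
    | succ q ih => rw [(hE q (by omega)).2.2, ← ih (by omega)]; rfl
  have hnlow : ∀ q (hq : q < I.n) j (v : Fin I.n), (v : ℕ) = E 0 (some (low (col q) j)) →
      ¬ I.G.graph.Adj (x q hq) v := fun q hq j v hv hadj =>
    (hE q hq).2.1.2.2.2.1 j ((view_adj I (hE q hq).1).mpr
      ⟨_, v, hx q hq, by rw [hv, hlow q hq], hadj⟩)
  have hnhigh : ∀ q (hq : q < I.n) j (v : Fin I.n), (v : ℕ) = E 0 (some (high (col q) j)) →
      ¬ I.G.graph.Adj (x q hq) v := fun q hq j v hv hadj =>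
    (hE q hq).2.1.2.2.2.2.1 j ((view_adj I (hE q hq).1).mpr
      ⟨_, v, hx q hq, by rw [hv, hhigh q hq], hadj⟩)
  have hproper : ∀ b (hb : b < I.n) a (ha : a < I.n), a < b → col a = col b →
      ¬ I.G.graph.Adj (x a ha) (x b hb) := by
    intro b
    induction b using Nat.strong_induction_on with
    | _ b ih =>
    intro hb a ha hab hcol hadj
    obtain ⟨m, t, ht, htt, htm, hwin⟩ :=
      exists_window (fun q hq => (hE q hq).2.2) a b hab hb
    have hnwin : ∀ j (hj : j < Nat.card W) (hjm : j ≤ m) (htn : t j < I.n),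
        ¬ I.G.graph.Adj (x b hb) (x (t j) htn) := fun j hj hjm htn h =>
      (hE b hb).2.1.2.2.1 ⟨j, hj⟩ ((view_adj I (hE b hb).1).mpr
        ⟨_, _, hx b hb, by rw [hx, ← hcol, hwin j hj hjm], h⟩)
    -- Otherwise the vertex `a` is still in the window, and its edge to `b` would be seen.
    have hm : Nat.card W ≤ m := by
      by_contra hcon
      have := hnwin m (by omega) le_rfl (by omega)
      simp only [htm] at this
      exact this hadj.symm
    -- If `a` were in one of the slots `low` and `high`, its edge to `b` would be seen.
    have hga : Guarded (col a) (view I.encode I.n (E a)) := by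
      rcases (hE a ha).2.1.2.2.2.2.2 with ⟨j, hj⟩ | ⟨j, hj⟩ | h
      · obtain ⟨u, hu, hu'⟩ := (view_same I (hE a ha).1).mp hj
        obtain rfl : u = x a ha := Fin.ext (by rw [hu, hx])
        exact absurd hadj.symm (hnlow b hb j _ (by rw [hu', hlow a ha, hcol]))
      · obtain ⟨u, hu, hu'⟩ := (view_same I (hE a ha).1).mp hj
        obtain rfl : u = x a ha := Fin.ext (by rw [hu, hx])
        exact absurd hadj.symm (hnhigh b hb j _ (by rw [hu', hhigh a ha, hcol]))
      · exact h
    have hgb : Guarded (col b) (view I.encode I.n (E b)) := by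
      rcases (hE b hb).2.1.2.2.2.2.2 with ⟨j, hj⟩ | ⟨j, hj⟩ | h
      · obtain ⟨u, hu, hu'⟩ := (view_same I (hE b hb).1).mp hj
        obtain rfl : u = x b hb := Fin.ext (by rw [hu, hx])
        exact absurd hadj (hnlow a ha j _ (by rw [hu', hlow b hb, hcol]))
      · obtain ⟨u, hu, hu'⟩ := (view_same I (hE b hb).1).mp hj
        obtain rfl : u = x b hb := Fin.ext (by rw [hu, hx])
        exact absurd hadj (hnhigh a ha j _ (by rw [hu', hhigh b hb, hcol]))
      · exact h
    have hpre : ∀ j, ∃ u : Fin I.n, (u : ℕ) = E 0 (some (low (col a) j)) ∧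
        I.G.ord u < I.G.ord (x a ha) := fun j => by
      obtain ⟨u, v, hu, hv, hlt⟩ := (view_lt I (hE a ha).1).mp (hga.1 j)
      obtain rfl : v = x a ha := Fin.ext (by rw [hv, hx])
      exact ⟨u, by rw [hu, hlow a ha], hlt⟩
    have hpost : ∀ j, ∃ v : Fin I.n, (v : ℕ) = E 0 (some (high (col a) j)) ∧
        I.G.ord (x b hb) < I.G.ord v := fun j => by
      obtain ⟨u, v, hu, hv, hlt⟩ := (view_lt I (hE b hb).1).mp (hgb.2.1 j)
      obtain rfl : u = x b hb := Fin.ext (by rw [hu, hx])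
      exact ⟨v, by rw [hv, hhigh b hb, hcol], hlt⟩
    choose pre hpre₁ hpre₂ using hpre
    choose post hpost₁ hpost₂ using hpost
    have htn : ∀ j : Fin (Nat.card W), t j < I.n := fun j => by
      have := (ht j (by omega)).2.1
      omega
    have hcolt : ∀ j : Fin (Nat.card W), col (t j) = col a := fun j => (ht j (by omega)).2.2
    -- The window has no conflicts with itself or with `a`, since `b` is least.
    have hma : ∀ j : Fin (Nat.card W), ¬ I.G.graph.Adj (x a ha) (x (t j) (htn j)) := fun j =>
      ih (t j) (ht j (by omega)).2.1 (htn j) a ha (ht j (by omega)).1 (hcolt j).symm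
    have hmm : ∀ i j : Fin (Nat.card W), i < j →
        ¬ I.G.graph.Adj (x (t j) (htn j)) (x (t i) (htn i)) := fun i j hij =>
      ih (t i) (ht i (by omega)).2.1 (htn i) _ _ (htt i j hij (by omega))
        ((hcolt j).trans (hcolt i).symm)
    have hmp : ∀ i j : Fin (Nat.card W), ¬ I.G.graph.Adj (x (t i) (htn i)) (pre j) := fun i j =>
      hnlow _ _ j _ (by rw [hpre₁, hcolt])
    have hmq : ∀ i j : Fin (Nat.card W), ¬ I.G.graph.Adj (x (t i) (htn i)) (post j) := fun i j =>
      hnhigh _ _ j _ (by rw [hpost₁, hcolt])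
    have hpp : ∀ i j, ¬ I.G.graph.Adj (pre i) (pre j) := fun i j h =>
      hga.2.2.2.2.1 i j ((view_adj I (hE a ha).1).mpr
        ⟨_, _, by rw [hpre₁, hlow a ha], by rw [hpre₁, hlow a ha], h⟩)
    have hpq : ∀ i j, ¬ I.G.graph.Adj (pre i) (post j) := fun i j h =>
      hga.2.2.2.2.2.1 i j ((view_adj I (hE a ha).1).mpr
        ⟨_, _, by rw [hpre₁, hlow a ha], by rw [hpost₁, hhigh a ha], h⟩)
    have hqq : ∀ i j, ¬ I.G.graph.Adj (post i) (post j) := fun i j h =>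
      hga.2.2.2.2.2.2 i j ((view_adj I (hE a ha).1).mpr
        ⟨_, _, by rw [hpost₁, hhigh a ha], by rw [hpost₁, hhigh a ha], h⟩)
    refine hfree (OrderedGraph.isInducedSubgraph_of_edge hH hadj
      (pre := pre) (mid := fun j => x (t j.rev) (htn _)) (post := fun j => post j.rev)
      (Set.range pre ∪ Set.range (fun j : Fin (Nat.card W) => x (t j) (htn j)) ∪
        Set.range post)
      (fun j => Or.inl (Or.inl ⟨j, rfl⟩)) (fun j => Or.inl (Or.inr ⟨j.rev, rfl⟩))
      (fun j => Or.inr ⟨j.rev, rfl⟩) ?_ ?_ ?_ ?_ ?_ ?_ hpre₂ ?_ ?_ (fun j => hpost₂ _))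
    · rintro _ ((⟨i, rfl⟩ | ⟨i, rfl⟩) | ⟨i, rfl⟩) _ ((⟨j, rfl⟩ | ⟨j, rfl⟩) | ⟨j, rfl⟩)
      · exact hpp i j
      · exact fun h => hmp j i h.symm
      · exact hpq i j
      · exact hmp i j
      · rcases lt_trichotomy i j with h | rfl | h
        · exact fun h' => hmm i j h h'.symm
        · exact I.G.graph.loopless.irrefl _
        · exact hmm j i h
      · exact hmq i j
      · exact fun h => hpq j i h.symm
      · exact fun h => hmq j i h.symm
      · exact hqq i j
    · rintro _ ((⟨i, rfl⟩ | ⟨i, rfl⟩) | ⟨i, rfl⟩)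
      · exact hnlow a ha i _ (hpre₁ i)
      · exact hma i
      · exact hnhigh a ha i _ (hpost₁ i)
    · rintro _ ((⟨i, rfl⟩ | ⟨i, rfl⟩) | ⟨i, rfl⟩)
      · exact hnlow b hb i _ (by rw [hpre₁, hcol])
      · exact hnwin i i.2 (by omega) (htn i)
      · exact hnhigh b hb i _ (by rw [hpost₁, hcol])
    · intro i j hij
      obtain ⟨u, v, hu, hv, hlt⟩ := (view_lt I (hE a ha).1).mp (hga.2.2.1 i j hij)
      obtain rfl : u = pre i := Fin.ext (by rw [hu, hpre₁, hlow a ha])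
      obtain rfl : v = pre j := Fin.ext (by rw [hv, hpre₁, hlow a ha])
      exact hlt
    · intro i j hij
      exact hmono _ _ _ _ (htt _ _ (Fin.rev_lt_rev.mpr hij) (by omega))
    · intro i j hij
      obtain ⟨u, v, hu, hv, hlt⟩ := (view_lt I (hE a ha).1).mp
        (hga.2.2.2.1 _ _ (Fin.rev_lt_rev.mpr hij))
      obtain rfl : u = post i.rev := Fin.ext (by rw [hu, hpost₁, hhigh a ha])
      obtain rfl : v = post j.rev := Fin.ext (by rw [hv, hpost₁, hhigh a ha])
      exact hlt
    · exact fun j => hmono _ _ _ _ (ht _ (by omega)).1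
    · exact fun j => hmono _ _ _ _ (ht _ (by omega)).2.1
  choose q hq using hsurj
  simp only at hq
  refine ⟨fun u => col (q u), fun u v huv hcol => ?_, fun u => ?_⟩
  · rcases lt_trichotomy (q u : ℕ) (q v) with h | h | h
    · exact hproper _ (q v).2 _ (q u).2 h hcol (by rwa [hq, hq])
    · exact huv.ne (by rw [← hq u, ← hq v, Fin.ext h])
    · exact hproper _ (q u).2 _ (q v).2 h hcol.symm (by rw [hq, hq]; exact huv.symm)
  · have := hxL (q u) (q u).2
    rwa [hq] at this

/-! ### Colorings yield runs -/

/-- The label of a vertex, or `n` for an empty slot. -/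
def slotCode {n : ℕ} (o : Option (Fin n)) : ℕ := o.elim n fun u => u

theorem slotCode_le {n : ℕ} (o : Option (Fin n)) : slotCode o ≤ n := by
  rcases o with _ | u
  · exact le_rfl
  · exact u.2.le

theorem eq_slotCode {n : ℕ} {u : Fin n} {o : Option (Fin n)} :
    (u : ℕ) = slotCode o ↔ o = some u := by
  rcases o with _ | v
  · simpa [slotCode] using u.2.ne
  · simp [slotCode, Fin.ext_iff, eq_comm]

/-- The greedy run for a coloring `c`: the slots `low` and `high` hold the true ends of the color
classes, and the vertices are colored in their order. -/
theorem exists_reach_of_listColorable (I : ListThreeInstance) (h : I.G.ListColorable I.L) (k : ℕ) :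
    ∃ s : Slot k → ℕ, (∀ a, s a ≤ I.n) ∧ Reach I.encode I.n (colorRules k) I.n s := by
  obtain ⟨c, hc, hcL⟩ := h
  let σ := Tuple.sort I.G.ord
  have hσ : StrictMono fun q => I.G.ord (σ q) :=
    (Tuple.monotone_sort I.G.ord).strictMono_of_injective (I.G.ord_injective.comp σ.injective)
  let l : Fin 3 → List (Fin I.n) := fun i => ((List.finRange I.n).map σ).filter fun u => c u = i
  have hl : ∀ i u, u ∈ l i ↔ c u = i := fun i u => by
    simp only [l, List.mem_filter, List.mem_map, List.mem_finRange, true_and, decide_eq_true_iff,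
      and_iff_right_iff_imp]
    exact fun _ => ⟨σ.symm u, σ.apply_symm_apply u⟩
  have hsort : ∀ i, (l i).Pairwise fun u v => I.G.ord u < I.G.ord v := fun i =>
    ((List.pairwise_lt_finRange I.n).map σ fun _ _ hab => hσ hab).filter _
  have hcl : ∀ i j (u : Fin I.n), (l i)[j]? = some u → c u = i := fun i j u hu =>
    (hl i u).mp (List.mem_of_getElem? hu)
  have hcr : ∀ i j (u : Fin I.n), (l i).reverse[j]? = some u → c u = i := fun i j u hu =>
    (hl i u).mp (List.mem_reverse.mp (List.mem_of_getElem? hu))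
  suffices ∀ q ≤ I.n, ∃ s : Slot k → ℕ, Reach I.encode I.n (colorRules k) q s ∧
      (∀ a, s a ≤ I.n) ∧
      (∀ u : Fin I.n, (u : ℕ) = s cur → ∀ r : Fin I.n, q ≤ r → I.G.ord u < I.G.ord (σ r)) ∧
      (∀ i j, ∀ u : Fin I.n, (u : ℕ) = s (win i j) → c u = i) ∧
      (∀ i (j : Fin k), s (low i j) = slotCode (l i)[(j : ℕ)]?) ∧
      ∀ i (j : Fin k), s (high i j) = slotCode (l i).reverse[(j : ℕ)]? by
    obtain ⟨s, hs, hle, -⟩ := this I.n le_rfl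
    exact ⟨s, hle, hs⟩
  intro q
  induction q with
  | zero =>
    refine fun _ => ⟨fun | cur => I.n | win _ _ => I.n | low i j => slotCode (l i)[(j : ℕ)]?
                         | high i j => slotCode (l i).reverse[(j : ℕ)]?, trivial, ?_, ?_, ?_,
      fun _ _ => rfl, fun _ _ => rfl⟩
    · rintro (_ | _ | _ | _)
      exacts [le_rfl, le_rfl, slotCode_le _, slotCode_le _]
    · exact fun u hu => absurd hu u.2.ne
    · exact fun _ _ u hu => absurd hu u.2.ne
  | succ q ih =>
    intro hq
    obtain ⟨s, hs, hle, hcur, hwin, hlow, hhigh⟩ := ih (by omega)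
    set x : Fin I.n := σ ⟨q, hq⟩ with hx
    let e : Option (Slot k) → ℕ := fun a => a.elim x s
    have he : ∀ a, e a ≤ I.n := by
      rintro (_ | a)
      exacts [x.2.le, hle a]
    have hallowed : Allowed (c x) (view I.encode I.n e) := by
      refine ⟨(view_memList I).mpr ⟨x, rfl, hcL x⟩, fun ho => ?_, fun j ha => ?_, fun j ha => ?_,
        fun j ha => ?_, ?_⟩
      · obtain ⟨u, hu⟩ := (view_occupied I).mp ho
        exact (view_lt I he).mpr ⟨u, x, hu, rfl, hcur u hu ⟨q, hq⟩ le_rfl⟩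
      · obtain ⟨u, v, hu, hv, ha⟩ := (view_adj I he).mp ha
        obtain rfl : u = x := Fin.ext hu
        exact hc _ _ ha (hwin _ _ v hv).symm
      · obtain ⟨u, v, hu, hv, ha⟩ := (view_adj I he).mp ha
        obtain rfl : u = x := Fin.ext hu
        exact hc _ _ ha (hcl _ _ v (eq_slotCode.mp (hv.trans (hlow _ _)))).symm
      · obtain ⟨u, v, hu, hv, ha⟩ := (view_adj I he).mp ha
        obtain rfl : u = x := Fin.ext hu
        exact hc _ _ ha (hcr _ _ v (eq_slotCode.mp (hv.trans (hhigh _ _)))).symm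
      · obtain ⟨r, hr, hrx⟩ := List.getElem_of_mem ((hl (c x) x).mpr rfl)
        have hlt := List.pairwise_iff_getElem.mp (hsort (c x))
        -- The vertex `x` is the entry `r` of its color class: one of the first `k`, one of the last
        -- `k`, or strictly between these.
        by_cases hr₁ : r < k
        · refine Or.inl ⟨⟨r, hr₁⟩, (view_same I he).mpr ⟨x, rfl, ?_⟩⟩
          exact (eq_slotCode.mpr (List.getElem?_eq_some_iff.mpr ⟨hr, hrx⟩)).trans
            (hlow _ ⟨r, hr₁⟩).symm
        by_cases hr₂ : (l (c x)).length - 1 - r < k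
        · refine Or.inr (Or.inl ⟨⟨_, hr₂⟩, (view_same I he).mpr ⟨x, rfl, ?_⟩⟩)
          refine (eq_slotCode.mpr ?_).trans (hhigh _ _).symm
          rw [List.getElem?_reverse (by simp only; omega), List.getElem?_eq_some_iff]
          refine ⟨by simp only; omega, Eq.trans ?_ hrx⟩
          congr 1
          simp only
          omega
        have hlow' : ∀ j : Fin k, ((l (c x))[(j : ℕ)]'(by omega) : ℕ) = s (low (c x) j) := fun j =>
          (eq_slotCode.mpr (List.getElem?_eq_getElem _)).trans (hlow _ _).symm
        have hhigh' : ∀ j : Fin k, ((l (c x))[(l (c x)).length - 1 - (j : ℕ)]'(by omega) : ℕ) =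
            s (high (c x) j) := fun j => by
          refine (eq_slotCode.mpr ?_).trans (hhigh _ _).symm
          rw [List.getElem?_reverse (by omega)]
          exact List.getElem?_eq_getElem _
        have hna : ∀ a b, (∀ u : Fin I.n, (u : ℕ) = e a → c u = c x) →
            (∀ u : Fin I.n, (u : ℕ) = e b → c u = c x) → ¬ (view I.encode I.n e).Adj a b := by
          intro a b ha hb h
          obtain ⟨u, v, hu, hv, h⟩ := (view_adj I he).mp h
          exact hc u v h ((ha u hu).trans (hb v hv).symm)
        have hcl' : ∀ (j : Fin k) (u : Fin I.n), (u : ℕ) = e (some (low (c x) j)) → c u = c x :=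
          fun j u hu => hcl _ _ u (eq_slotCode.mp (hu.trans (hlow _ _)))
        have hcr' : ∀ (j : Fin k) (u : Fin I.n), (u : ℕ) = e (some (high (c x) j)) → c u = c x :=
          fun j u hu => hcr _ _ u (eq_slotCode.mp (hu.trans (hhigh _ _)))
        refine Or.inr (Or.inr ⟨fun j => ?_, fun j => ?_, fun j j' hj => ?_, fun j j' hj => ?_,
          fun j j' => hna _ _ (hcl' j) (hcl' j'), fun j j' => hna _ _ (hcl' j) (hcr' j'),
          fun j j' => hna _ _ (hcr' j) (hcr' j')⟩)
        · refine (view_lt I he).mpr ⟨_, x, hlow' j, rfl, ?_⟩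
          have := hlt j r (by omega) hr (by omega)
          rwa [hrx] at this
        · refine (view_lt I he).mpr ⟨x, _, rfl, hhigh' j, ?_⟩
          have := hlt r ((l (c x)).length - 1 - j) hr (by omega) (by omega)
          rwa [hrx] at this
        · exact (view_lt I he).mpr ⟨_, _, hlow' j, hlow' j', hlt _ _ _ _ hj⟩
        · exact (view_lt I he).mpr ⟨_, _, hhigh' j', hhigh' j, hlt _ _ _ _ (by omega)⟩
    refine ⟨fun a => e (next (c x) a), ⟨e, he, hs, colorRule k (c x),
      List.mem_map_of_mem (List.mem_finRange _), by simpa [colorRule] using hallowed, rfl⟩,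
      fun a => he _, ?_, ?_, hlow, hhigh⟩
    · intro u hu r hr
      obtain rfl : u = x := Fin.ext hu
      exact hσ (Fin.lt_def.mpr (Nat.lt_of_succ_le hr))
    · intro i j u hu
      simp only [next] at hu
      split_ifs at hu with h₁ h₂
      · obtain rfl : u = x := Fin.ext hu
        exact h₁.symm
      · exact hwin _ _ u hu
      · exact hwin _ _ u hu

end ListThreeInstance

theorem theorem1p5 {W : Type*} [Finite W] (H : OrderedGraph W)
    (hH : H.graph.edgeSet.encard ≤ 1) :
    OrderedListThreeColoringPolyTime H := by
  refine StackProg.solvableInPolyTime_of_reach (Slot.colorRules (Nat.card W)) fun I => ?_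
  rw [ListThreeInstance.countP_encode]
  constructor
  · exact fun h => ListThreeInstance.exists_reach_of_listColorable I.1 h _
  · rintro ⟨s, -, hs⟩
    obtain ⟨E, col, -, hE⟩ := ListThreeInstance.exists_sequence_of_reach hs
    exact ListThreeInstance.listColorable_of_sequence hH I.1 I.2 hE
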